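/- Let $M\ge 1$, let $x_1<x_2<\cdots<x_M$ and $y_1,\dots,y_M$ be real numbers, let $\lambda>0$, and let $E:\mathbb{R}\times\mathbb{R}\to\mathbb{R}$ be such that, for every $v\in\mathbb{R}$, the function $E(\cdot,v)$ is strictly convex and coercive ($E(u,v)\to+\infty$ as $|u|\to\infty$). Let ${\rm Lip}(\mathbb{R})$ be the space of Lipschitz functions $f:\mathbb{R}\to\mathbb{R}$, with Lipschitz constant $L(f)=\sup_{s\neq t}|f(s)-f(t)|/|s-t|$. It is the dual of ${\rm D}(L_1(\mathbb{R}))\oplus{\rm span}({\rm e}^{-(\cdot)^2})$ through $\langle f,{\rm D}g+c\,{\rm e}^{-(\cdot)^2}\rangle=-\int f'g+c\int f(t){\rm e}^{-t^2}{\rm d}t$, and carries the corresponding weak* topology. Let $$\mathcal V_{\rm Lip}=\operatorname*{arg\,min}_{f\in{\rm Lip}(\mathbb{R})}\Big(\sum_{m=1}^M E(f(x_m),y_m)+\lambda L(f)\Big).$$ 1. $\mathcal V_{\rm Lip}$ is a nonempty, convex and weak*-compact subset of ${\rm Lip}(\mathbb{R})$. 2. There is a unique vector ${\bf z}=(z_m)\in\mathbb{R}^M$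 such that $\mathcal V_{\rm Lip}$ is the set of minimizers of $L(f)$ over the $f\in{\rm Lip}(\mathbb{R})$ with $f(x_m)=z_m$ for all $m$. For this ${\bf z}$, moreover: 3. Every $f\in\mathcal V_{\rm Lip}$ satisfies $L(f)=L_{\min}$, where $L_{\min}=\max_{2\le m\le M}\left|\frac{z_m-z_{m-1}}{x_m-x_{m-1}}\right|$ (and $L_{\min}=0$ if $M=1$). Every $L_{\min}$-Lipschitz function $f$ with $f(x_m)=z_m$ for all $m$ belongs to $\mathcal V_{\rm Lip}$. 4. Let $\mathcal R=\{\alpha_1(1,L_{\min})+\alpha_2(1,-L_{\min}):\alpha_1,\alpha_2\ge 0\}$, $\mathcal L=-\mathcal R$, $\mathcal R_m=(x_m,z_m)+\mathcal R$ and $\mathcal L_m=(x_m,z_m)+\mathcal L$ for $1\le m\le M$, and $\mathcal R_0=\mathcal L_{M+1}=\mathbb{R}^2$. Then $$\{(x,y)\in\mathbb{R}^2:\exists f\in\mathcal V_{\rm Lip},\ y=f(x)\}=\bigcup_{m=1}^{M+1}\left(\mathcal R_{m-1}\cap\mathcal L_m\right).$$ 5. Let ${\rm TV}^{(2)}(f)=\sup\int_{\mathbb{R}}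 f\varphi''$, the supremum being over the smooth compactly supported $\varphi$ with $\|\varphi\|_\infty\le 1$, and let ${\rm BV}^{(2)}(\mathbb{R})$ be the space of continuous $f:\mathbb{R}\to\mathbb{R}$ with ${\rm TV}^{(2)}(f)<\infty$. If $M\ge 2$, then every minimizer of ${\rm TV}^{(2)}(f)$ over the $f\in{\rm BV}^{(2)}(\mathbb{R})$ with $f(x_m)=z_m$ for all $m$ belongs to $\mathcal V_{\rm Lip}$. Moreover (for every $M\ge1$), some continuous function that is piecewise linear with finitely many pieces is such a minimizer and belongs to $\mathcal V_{\rm Lip}$. -/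

import Mathlib

open Set Filter Topology MeasureTheory
open scoped Pointwise ContDiff NNReal ENNReal

/-- The space `Lip(ℝ)` of Lipschitz-continuous functions `ℝ → ℝ`. -/
def LipR : Submodule ℝ (ℝ → ℝ) where
  carrier := {f | ∃ K : ℝ≥0, LipschitzWith K f}
  add_mem' := by
    rintro f g ⟨K, hf⟩ ⟨K', hg⟩
    exact ⟨K + K', hf.add hg⟩
  zero_mem' := ⟨0, LipschitzWith.const 0⟩
  smul_mem' := by
    rintro c f ⟨K, hf⟩
    exact ⟨‖c‖₊ * K, (lipschitzWith_smul c).comp hf⟩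

/-- The Lipschitz constant `L(f) = sup_{s ≠ t} |f s - f t| / |s - t|`
(a finite supremum for `f ∈ Lip(ℝ)`). -/
noncomputable def lipConst (f : ℝ → ℝ) : ℝ :=
  ⨆ p : {p : ℝ × ℝ // p.1 ≠ p.2}, |f p.1.1 - f p.1.2| / |p.1.1 - p.1.2|

/-! ### The weak* topology of `Lip(ℝ)` -/

/-- The derivative of a Lipschitz function may be integrated against an `L¹` function. -/
theorem LipR.integrable_deriv_mul (f : LipR) (g : Lp ℝ 1 (volume : Measure ℝ)) :
    Integrable (fun t => deriv (f : ℝ → ℝ) t * g t) := by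
  obtain ⟨K, hK⟩ := f.2
  exact (L1.integrable_coeFn g).bdd_mul (measurable_deriv _).aestronglyMeasurable
    (Eventually.of_forall fun t => norm_deriv_le_of_lipschitz hK)

/-- A Lipschitz function may be integrated against the Gaussian. -/
theorem LipR.integrable_mul_gauss (f : LipR) :
    Integrable (fun t => (f : ℝ → ℝ) t * Real.exp (-t ^ 2)) := by
  obtain ⟨K, hK⟩ := f.2
  have h0 : Integrable (fun t : ℝ => Real.exp (-t ^ 2)) := by
    simpa using integrable_exp_neg_mul_sq (b := 1) one_pos
  have h1 : Integrable (fun t : ℝ => t * Real.exp (-t ^ 2)) := by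
    simpa using integrable_mul_exp_neg_mul_sq (b := 1) one_pos
  refine ((h0.const_mul |(f : ℝ → ℝ) 0|).add (h1.abs.const_mul (K : ℝ))).mono' ?_ ?_
  · exact (hK.continuous.mul (by fun_prop)).aestronglyMeasurable
  · refine Eventually.of_forall fun t => ?_
    have h2 : |(f : ℝ → ℝ) t - (f : ℝ → ℝ) 0| ≤ K * |t| := by
      simpa [Real.dist_eq] using hK.dist_le_mul t 0
    have h3 : |(f : ℝ → ℝ) t| ≤ |(f : ℝ → ℝ) 0| + K * |t| := by
      have := abs_add_le ((f : ℝ → ℝ) t - (f : ℝ → ℝ) 0) ((f : ℝ → ℝ) 0)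
      rw [sub_add_cancel] at this
      linarith
    have h4 := Real.exp_pos (-t ^ 2)
    simp only [Pi.add_apply, Real.norm_eq_abs, abs_mul, abs_of_pos h4]
    nlinarith

/-- The duality pairing between `Lip(ℝ)` and its predual
`D(L¹(ℝ)) ⊕ span(exp(-(·)²))`. The element `D g + c exp(-(·)²)` of the predual, with `g ∈ L¹(ℝ)`
and `c ∈ ℝ`, is represented by the pair `(g, c)` that determines it, and
`⟨f, D g + c exp(-(·)²)⟩ = -∫ f' g + c ∫ f(t) exp(-t²) dt`. -/
noncomputable def lipPairing :
    LipR →ₗ[ℝ] (Lp ℝ 1 (volume : Measure ℝ) × ℝ) →ₗ[ℝ] ℝ :=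
  LinearMap.mk₂ ℝ
    (fun f w => -(∫ t, deriv (f : ℝ → ℝ) t * w.1 t)
      + w.2 * ∫ t, (f : ℝ → ℝ) t * Real.exp (-t ^ 2))
    (by
      intro f₁ f₂ w
      have hd : (fun t => deriv ((f₁ + f₂ : LipR) : ℝ → ℝ) t * w.1 t) =ᵐ[volume]
          fun t => deriv (f₁ : ℝ → ℝ) t * w.1 t + deriv (f₂ : ℝ → ℝ) t * w.1 t := by
        obtain ⟨K₁, h₁⟩ := f₁.2
        obtain ⟨K₂, h₂⟩ := f₂.2
        filter_upwards [h₁.ae_differentiableAt, h₂.ae_differentiableAt] with t a b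
        rw [Submodule.coe_add, deriv_add a b, add_mul]
      have hg : (fun t => ((f₁ + f₂ : LipR) : ℝ → ℝ) t * Real.exp (-t ^ 2)) =
          fun t => (f₁ : ℝ → ℝ) t * Real.exp (-t ^ 2) + (f₂ : ℝ → ℝ) t * Real.exp (-t ^ 2) := by
        funext t
        rw [Submodule.coe_add, Pi.add_apply, add_mul]
      rw [integral_congr_ae hd, hg,
        integral_add (LipR.integrable_deriv_mul f₁ w.1) (LipR.integrable_deriv_mul f₂ w.1),
        integral_add (LipR.integrable_mul_gauss f₁) (LipR.integrable_mul_gauss f₂)]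
      ring)
    (by
      intro c f w
      have hd : (fun t => deriv ((c • f : LipR) : ℝ → ℝ) t * w.1 t) =ᵐ[volume]
          fun t => c * (deriv (f : ℝ → ℝ) t * w.1 t) := by
        obtain ⟨K, h⟩ := f.2
        filter_upwards [h.ae_differentiableAt] with t a
        rw [Submodule.coe_smul, deriv_const_smul c a, smul_eq_mul, mul_assoc]
      have hg : (fun t => ((c • f : LipR) : ℝ → ℝ) t * Real.exp (-t ^ 2)) =
          fun t => c * ((f : ℝ → ℝ) t * Real.exp (-t ^ 2)) := by
        funext t
        rw [Submodule.coe_smul, Pi.smul_apply, smul_eq_mul, mul_assoc]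
      rw [integral_congr_ae hd, hg, integral_const_mul, integral_const_mul, smul_eq_mul]
      ring)
    (by
      intro f w₁ w₂
      have hd : (fun t => deriv (f : ℝ → ℝ) t * (w₁ + w₂).1 t) =ᵐ[volume]
          fun t => deriv (f : ℝ → ℝ) t * w₁.1 t + deriv (f : ℝ → ℝ) t * w₂.1 t := by
        filter_upwards [Lp.coeFn_add w₁.1 w₂.1] with t a
        rw [Prod.fst_add, a, Pi.add_apply, mul_add]
      rw [integral_congr_ae hd,
        integral_add (LipR.integrable_deriv_mul f w₁.1) (LipR.integrable_deriv_mul f w₂.1),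
        Prod.snd_add]
      ring)
    (by
      intro c f w
      have hd : (fun t => deriv (f : ℝ → ℝ) t * (c • w).1 t) =ᵐ[volume]
          fun t => c * (deriv (f : ℝ → ℝ) t * w.1 t) := by
        filter_upwards [Lp.coeFn_smul c w.1] with t a
        rw [Prod.smul_fst, a, Pi.smul_apply, smul_eq_mul]
        ring
      rw [integral_congr_ae hd, integral_const_mul, Prod.smul_snd, smul_eq_mul, smul_eq_mul]
      ring)

/-- The weak* topology of `Lip(ℝ)`: the coarsest topology for which all the functionals
`f ↦ ⟨f, w⟩`, with `w` in the predual, are continuous. -/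
noncomputable abbrev lipWeakStar : TopologicalSpace LipR :=
  TopologicalSpace.induced (fun f w => lipPairing f w) Pi.topologicalSpace

/-- Compactness of a subset of `Lip(ℝ)` in the weak* topology. -/
def IsWeakStarCompact (S : Set LipR) : Prop :=
  @IsCompact LipR lipWeakStar S

/-! ### The minimization problems -/

/-- The cost `∑ₘ E(f(xₘ), yₘ) + lam * L(f)`. -/
noncomputable def lipCost {M : ℕ} (E : ℝ → ℝ → ℝ) (lam : ℝ) (x y : Fin M → ℝ) (f : LipR) : ℝ :=
  ∑ m, E ((f : ℝ → ℝ) (x m)) (y m) + lam * lipConst (f : ℝ → ℝ)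

/-- The solution set of the Lipschitz-regularized problem over `Lip(ℝ)`. -/
def lipSolutions {M : ℕ} (E : ℝ → ℝ → ℝ) (lam : ℝ) (x y : Fin M → ℝ) : Set LipR :=
  {f | ∀ g : LipR, lipCost E lam x y f ≤ lipCost E lam x y g}

/-- `f` interpolates the points `(xₘ, zₘ)`. -/
def Interpolates {M : ℕ} (x z : Fin M → ℝ) (f : ℝ → ℝ) : Prop :=
  ∀ m, f (x m) = z m

/-- The solution set of: minimize `L(f)` over `f ∈ Lip(ℝ)` such that `f(xₘ) = zₘ` for all `m`. -/
def lipInterpSolutions {M : ℕ} (x z : Fin M → ℝ) : Set LipR :=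
  {f | Interpolates x z f ∧ ∀ g : LipR, Interpolates x z g → lipConst f ≤ lipConst g}

/-- The largest modulus of a slope between consecutive points, for `M = n + 1` points
(`0` if there is only one point). -/
noncomputable def maxSlope {n : ℕ} (x z : Fin (n + 1) → ℝ) : ℝ :=
  ⨆ i : Fin n, |(z i.succ - z i.castSucc) / (x i.succ - x i.castSucc)|

/-- The union of the graphs of the functions in `V`. -/
def unionGraph (V : Set LipR) : Set (ℝ × ℝ) :=
  {p | ∃ f ∈ V, p.2 = (f : ℝ → ℝ) p.1}

/-- The right planar cone of slope `L`. -/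
def rightCone (L : ℝ) : Set (ℝ × ℝ) :=
  {p | ∃ a b : ℝ, 0 ≤ a ∧ 0 ≤ b ∧ p = a • ((1, L) : ℝ × ℝ) + b • ((1, -L) : ℝ × ℝ)}

/-- The left planar cone of slope `L`. -/
def leftCone (L : ℝ) : Set (ℝ × ℝ) :=
  -rightCone L

/-- The right cone with apex at the `m`-th point, where points are counted from `1` to `M`;
the whole plane for `m = 0` (and, by default, for `m > M`, which is not used). -/
def rightConeAt {M : ℕ} (x z : Fin M → ℝ) (L : ℝ) (m : ℕ) : Set (ℝ × ℝ) :=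
  if h : 1 ≤ m ∧ m ≤ M then
    ((x ⟨m - 1, by omega⟩, z ⟨m - 1, by omega⟩) : ℝ × ℝ) +ᵥ rightCone L
  else univ

/-- The left cone with apex at the `m`-th point, where points are counted from `1` to `M`;
the whole plane for `m = M + 1` (and, by default, for other `m` out of range, which are not
used). -/
def leftConeAt {M : ℕ} (x z : Fin M → ℝ) (L : ℝ) (m : ℕ) : Set (ℝ × ℝ) :=
  if h : 1 ≤ m ∧ m ≤ M then
    ((x ⟨m - 1, by omega⟩, z ⟨m - 1, by omega⟩) : ℝ × ℝ) +ᵥ leftCone L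
  else univ

/-! ### Second-order total variation and piecewise-linear functions -/

/-- The second-order total variation `TV⁽²⁾(f) = ‖D² f‖_M`: the supremum of
`⟨D² f, φ⟩ = ∫ f φ''` over the smooth compactly supported `φ` with `|φ| ≤ 1`. -/
noncomputable def TV2 (f : ℝ → ℝ) : ℝ≥0∞ :=
  ⨆ (φ : ℝ → ℝ) (_ : ContDiff ℝ ∞ φ) (_ : HasCompactSupport φ) (_ : ∀ t, |φ t| ≤ 1),
    ENNReal.ofReal (∫ t, f t * deriv (deriv φ) t)

/-- The space `BV⁽²⁾(ℝ)` of functions of finite second-order total variation. Every distribution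
whose second derivative is a bounded measure is a continuous function; as the point values
matter, the elements are taken to be the continuous representatives. -/
def BV2 : Set (ℝ → ℝ) :=
  {f | Continuous f ∧ TV2 f < ⊤}

/-- The solution set of: minimize `TV⁽²⁾(f)` over `f ∈ BV⁽²⁾(ℝ)` such that `f(xₘ) = zₘ` for
all `m`. -/
def tv2InterpSolutions {M : ℕ} (x z : Fin M → ℝ) : Set (ℝ → ℝ) :=
  {f | f ∈ BV2 ∧ Interpolates x z f ∧ ∀ g ∈ BV2, Interpolates x z g → TV2 f ≤ TV2 g}

/-- Continuous and piecewise linear: `f` is continuous and, for some finite set `T` of knots,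
affine on every interval (bounded or not) that contains no knot. -/
def IsCPWL (f : ℝ → ℝ) : Prop :=
  Continuous f ∧ ∃ T : Finset ℝ, ∀ I : Set ℝ, I.OrdConnected → Disjoint I (T : Set ℝ) →
    ∃ a b : ℝ, ∀ t ∈ I, f t = a * t + b

/-! Sampling at the data points makes the problem finite-dimensional. A Lipschitz function with
values `z` there has constant at least `maxSlope x z`, and Lipschitz extension attains this bound.
Hence the optimal cost for given `z` is `valueCost`, which is continuous, coercive and strictly
convex, so it has a unique minimizer. The solutions are then exactly the `maxSlope`-Lipschitz
interpolants of that `z` (`lipSolutions_eq_of_valueCost_min`, `mem_lipInterpSolutions_iff`).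
Convexity is immediate from this description. Weak* compactness follows from Arzelà–Ascoli, and the
union of graphs from extending Lipschitz data with one extra point.

For the second-order total variation, duality bounds `TV2 f` below by the variation of the chord
slopes of `f` along any list of successive intervals (`ofReal_listVariation_chordSlope_le_TV2`). The
linear spline has slope jumps only at interior data points and reaches the bound given by the data
intervals. Every minimizer therefore has `TV2` at most the variation of the data slopes. If one of
its chords were steeper than all of these, inserting that chord into the list would give a strictly
larger variation, a contradiction (`sub_le_mul_of_TV2_le`). So a minimizer through at least two
points is `maxSlope`-Lipschitz. -/

/-! ### A smooth approximation of the positive part -/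

/-- A smooth function that agrees with the positive part outside `[0, 1]`. -/
noncomputable def smoothHinge (x : ℝ) : ℝ := x * Real.smoothTransition x

theorem contDiff_smoothHinge : ContDiff ℝ ∞ smoothHinge :=
  contDiff_id.mul Real.smoothTransition.contDiff

theorem smoothHinge_of_nonpos {x : ℝ} (hx : x ≤ 0) : smoothHinge x = 0 := by
  simp [smoothHinge, Real.smoothTransition.zero_of_nonpos hx]

theorem smoothHinge_of_one_le {x : ℝ} (hx : 1 ≤ x) : smoothHinge x = x := by
  simp [smoothHinge, Real.smoothTransition.one_of_one_le hx]

theorem abs_smoothHinge_sub_le (x : ℝ) : |smoothHinge x - max x 0| ≤ 1 := by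
  rcases le_total x 0 with h | h
  · simp [smoothHinge_of_nonpos h, h]
  rcases le_total 1 x with h1 | h1
  · simp [smoothHinge_of_one_le h1, h]
  · have h2 := Real.smoothTransition.nonneg x
    have h3 := Real.smoothTransition.le_one x
    rw [max_eq_left h, smoothHinge, abs_le]
    constructor <;> nlinarith

theorem differentiable_smoothHinge : Differentiable ℝ smoothHinge :=
  contDiff_smoothHinge.differentiable (by simp)

theorem contDiff_deriv_smoothHinge : ContDiff ℝ ∞ (deriv smoothHinge) :=
  (contDiff_infty_iff_deriv.1 contDiff_smoothHinge).2

theorem continuous_deriv_deriv_smoothHinge : Continuous (deriv (deriv smoothHinge)) :=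
  (contDiff_infty_iff_deriv.1 contDiff_deriv_smoothHinge).2.continuous

theorem deriv_smoothHinge_of_neg {x : ℝ} (hx : x < 0) : deriv smoothHinge x = 0 := by
  have : smoothHinge =ᶠ[𝓝 x] fun _ => 0 := by
    filter_upwards [Iio_mem_nhds hx] with y hy using smoothHinge_of_nonpos (le_of_lt hy)
  simpa using this.deriv_eq

theorem deriv_smoothHinge_of_one_lt {x : ℝ} (hx : 1 < x) : deriv smoothHinge x = 1 := by
  have : smoothHinge =ᶠ[𝓝 x] fun y => y := by
    filter_upwards [Ioi_mem_nhds hx] with y hy using smoothHinge_of_one_le (le_of_lt hy)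
  simpa using this.deriv_eq

theorem support_deriv_deriv_smoothHinge :
    Function.support (deriv (deriv smoothHinge)) ⊆ Ioc (-1) 2 := by
  intro x hx
  by_contra h
  apply hx
  rcases lt_or_ge x 0 with h0 | h0
  · have : deriv smoothHinge =ᶠ[𝓝 x] fun _ => 0 := by
      filter_upwards [Iio_mem_nhds h0] with y hy using deriv_smoothHinge_of_neg hy
    simpa using this.deriv_eq
  · have h1 : 1 < x := by
      by_contra h2
      exact h ⟨by linarith, by linarith⟩
    have : deriv smoothHinge =ᶠ[𝓝 x] fun _ => 1 := by
      filter_upwards [Ioi_mem_nhds h1] with y hy using deriv_smoothHinge_of_one_lt hy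
    simpa using this.deriv_eq

theorem integral_deriv_deriv_smoothHinge :
    ∫ u in (-1 : ℝ)..2, deriv (deriv smoothHinge) u = 1 := by
  rw [intervalIntegral.integral_deriv_eq_sub
    (fun x _ => contDiff_deriv_smoothHinge.differentiable (by simp) x)
    (continuous_deriv_deriv_smoothHinge.intervalIntegrable _ _),
    deriv_smoothHinge_of_neg (x := -1) (by norm_num),
    deriv_smoothHinge_of_one_lt (x := 2) (by norm_num), sub_zero]

/-- Testing against the rescaled second derivative of `smoothHinge`. -/
theorem integral_mul_deriv_deriv_smoothHinge (f : ℝ → ℝ) (t : ℝ) {δ : ℝ} (hδ : 0 < δ) :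
    ∫ x, f x * (deriv (deriv smoothHinge) ((x - t) / δ) / δ) =
      ∫ u in (-1 : ℝ)..2, f (t + δ * u) * deriv (deriv smoothHinge) u := by
  set g : ℝ → ℝ := fun u => f (t + δ * u) * deriv (deriv smoothHinge) u with hg
  have hsupp : Function.support g ⊆ Ioc (-1) 2 :=
    (Function.support_mul_subset_right _ _).trans support_deriv_deriv_smoothHinge
  rw [intervalIntegral.integral_eq_integral_of_support_subset hsupp]
  have h1 : (fun x => f x * (deriv (deriv smoothHinge) ((x - t) / δ) / δ)) =
      fun x => δ⁻¹ * g ((x - t) / δ) := by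
    funext x
    simp only [hg]
    rw [mul_div_cancel₀ _ hδ.ne', add_sub_cancel]
    field_simp
  rw [h1, integral_const_mul, integral_sub_right_eq_self (fun x => g (x / δ)) t,
    Measure.integral_comp_div, abs_of_pos hδ, smul_eq_mul, inv_mul_cancel_left₀ hδ.ne']

/-- The kernel is an approximate identity at `t`: its mass is the jump of `deriv smoothHinge` from 0
to 1. -/
theorem tendsto_integral_mul_deriv_deriv_smoothHinge {f : ℝ → ℝ} (hf : Continuous f) (t : ℝ) :
    Tendsto (fun δ => ∫ x, f x * (deriv (deriv smoothHinge) ((x - t) / δ) / δ)) (𝓝[>] 0)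
      (𝓝 (f t)) := by
  have hc : Continuous fun δ : ℝ =>
      ∫ u in (-1 : ℝ)..2, f (t + δ * u) * deriv (deriv smoothHinge) u := by
    apply intervalIntegral.continuous_parametric_intervalIntegral_of_continuous'
    have := continuous_deriv_deriv_smoothHinge
    simp only [Function.uncurry_def]
    fun_prop
  have h0 := (hc.tendsto 0).mono_left (nhdsWithin_le_nhds (s := Ioi 0))
  simp only [zero_mul, add_zero, intervalIntegral.integral_const_mul,
    integral_deriv_deriv_smoothHinge, mul_one] at h0
  refine h0.congr' ?_
  filter_upwards [self_mem_nhdsWithin] with δ hδ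
  exact (integral_mul_deriv_deriv_smoothHinge f t hδ).symm

/-! ### Lower bounds for the second-order total variation -/

/-- If the compactly supported piecewise-linear function `∑ₜ cₜ (· - t)₊` is bounded by one, then
its pairing `∑ₜ cₜ f(t)` with the second derivative of `f` is at most `TV⁽²⁾(f)`. -/
theorem ofReal_linearCombination_le_TV2 {f : ℝ → ℝ} (hf : Continuous f) (c : ℝ →₀ ℝ)
    (h0 : Finsupp.linearCombination ℝ (fun _ => (1 : ℝ)) c = 0)
    (h1 : Finsupp.linearCombination ℝ (fun t : ℝ => t) c = 0)
    (hc : ∀ x, |Finsupp.linearCombination ℝ (fun t : ℝ => max (x - t) 0) c| ≤ 1) :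
    ENNReal.ofReal (Finsupp.linearCombination ℝ f c) ≤ TV2 f := by
  simp only [Finsupp.linearCombination_apply, Finsupp.sum, smul_eq_mul, mul_one] at h0 h1 hc ⊢
  set C : ℝ := ∑ t ∈ c.support, |c t| with hC
  have hC0 : 0 ≤ C := Finset.sum_nonneg fun _ _ => abs_nonneg _
  -- Each hinge is smoothed at scale `δ`, with uniform error at most `δ`; hence the bound `1 + C *
  -- δ` below.
  set ψ : ℝ → ℝ → ℝ := fun δ x => ∑ t ∈ c.support, c t * (δ * smoothHinge ((x - t) / δ)) with hψ
  have hderiv : ∀ δ > 0, deriv (deriv (ψ δ)) =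
      fun x => ∑ t ∈ c.support, c t * (deriv (deriv smoothHinge) ((x - t) / δ) / δ) := by
    intro δ hδ
    have hlin : ∀ t x : ℝ, HasDerivAt (fun x => (x - t) / δ) (1 / δ) x := fun t x =>
      ((hasDerivAt_id x).sub_const t).div_const δ
    have e1 : deriv (ψ δ) = fun x => ∑ t ∈ c.support, c t * deriv smoothHinge ((x - t) / δ) := by
      funext x
      refine HasDerivAt.deriv (HasDerivAt.fun_sum fun t _ => ?_)
      have := (((differentiable_smoothHinge _).hasDerivAt.comp x (hlin t x)).const_mul δ).const_mul
        (c t)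
      refine this.congr_deriv ?_
      field_simp
    rw [e1]
    funext x
    refine HasDerivAt.deriv (HasDerivAt.fun_sum fun t _ => ?_)
    have := ((((contDiff_deriv_smoothHinge.differentiable (by simp)) _).hasDerivAt.comp x
      (hlin t x))).const_mul (c t)
    refine this.congr_deriv ?_
    ring
  have hsmooth : ∀ δ, ContDiff ℝ ∞ (ψ δ) := by
    intro δ
    refine ContDiff.sum fun t _ => contDiff_const.mul (contDiff_const.mul ?_)
    exact contDiff_smoothHinge.comp ((contDiff_id.sub contDiff_const).div_const δ)
  have hcomp : ∀ δ > 0, HasCompactSupport (ψ δ) := by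
    intro δ hδ
    set B : ℝ := ∑ t ∈ c.support, |t|
    have hB : ∀ t ∈ c.support, |t| ≤ B := fun t ht =>
      Finset.single_le_sum (f := fun t : ℝ => |t|) (fun _ _ => abs_nonneg _) ht
    refine HasCompactSupport.intro (isCompact_Icc (a := -B) (b := B + δ)) fun x hx => ?_
    rw [mem_Icc, not_and_or, not_le, not_le] at hx
    rcases hx with hx | hx
    · refine Finset.sum_eq_zero fun t ht => ?_
      have := (abs_le.1 (hB t ht)).1
      rw [smoothHinge_of_nonpos (div_nonpos_of_nonpos_of_nonneg (by linarith) hδ.le)]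
      simp
    -- Beyond all knots the sum is affine in `x`, and the two moment conditions make it vanish.
    · have : ψ δ x = ∑ t ∈ c.support, (c t * x - c t * t) := by
        refine Finset.sum_congr rfl fun t ht => ?_
        have := (abs_le.1 (hB t ht)).2
        rw [smoothHinge_of_one_le ((one_le_div hδ).2 (by linarith)), mul_div_cancel₀ _ hδ.ne']
        ring
      rw [this, Finset.sum_sub_distrib, ← Finset.sum_mul, h0, h1]
      ring
  have hbound : ∀ δ > 0, ∀ x, |ψ δ x| ≤ 1 + C * δ := by
    intro δ hδ x
    have e : ψ δ x = ∑ t ∈ c.support, c t * max (x - t) 0 +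
        ∑ t ∈ c.support, c t * (δ * (smoothHinge ((x - t) / δ) - max ((x - t) / δ) 0)) := by
      rw [← Finset.sum_add_distrib]
      refine Finset.sum_congr rfl fun t _ => ?_
      have : max (x - t) 0 = δ * max ((x - t) / δ) 0 := by
        rw [mul_max_of_nonneg _ _ hδ.le, mul_div_cancel₀ _ hδ.ne', mul_zero]
      rw [this]
      ring
    rw [e]
    refine (abs_add_le _ _).trans (add_le_add (hc x) ?_)
    refine (Finset.abs_sum_le_sum_abs _ _).trans ?_
    rw [hC, Finset.sum_mul]
    refine Finset.sum_le_sum fun t _ => ?_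
    rw [abs_mul, abs_mul, abs_of_pos hδ]
    refine mul_le_mul_of_nonneg_left ?_ (abs_nonneg _)
    exact mul_le_of_le_one_right hδ.le (abs_smoothHinge_sub_le _)
  have hle : ∀ δ > 0, ENNReal.ofReal ((1 + C * δ)⁻¹ *
      ∑ t ∈ c.support, c t * ∫ x, f x * (deriv (deriv smoothHinge) ((x - t) / δ) / δ)) ≤
        TV2 f := by
    intro δ hδ
    have hpos : 0 < 1 + C * δ := by positivity
    have h_integral : ∫ t, f t * deriv (deriv fun x => (1 + C * δ)⁻¹ * ψ δ x) t = (1 + C * δ)⁻¹ *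
        ∑ t ∈ c.support, c t * ∫ x, f x * (deriv (deriv smoothHinge) ((x - t) / δ) / δ) := by
      have e : deriv (deriv fun x => (1 + C * δ)⁻¹ * ψ δ x) =
          fun x => (1 + C * δ)⁻¹ * deriv (deriv (ψ δ)) x := by
        simp only [deriv_const_mul_field']
      rw [e, hderiv δ hδ]
      have : ∀ x, f x * ((1 + C * δ)⁻¹ *
          ∑ t ∈ c.support, c t * (deriv (deriv smoothHinge) ((x - t) / δ) / δ)) =
          (1 + C * δ)⁻¹ * ∑ t ∈ c.support,
            c t * (f x * (deriv (deriv smoothHinge) ((x - t) / δ) / δ)) := by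
        intro x
        rw [mul_left_comm, Finset.mul_sum]
        congr 1
        exact Finset.sum_congr rfl fun t _ => by ring
      simp only [this]
      rw [integral_const_mul, integral_finsetSum]
      · simp only [integral_const_mul]
      · intro t _
        refine Integrable.const_mul (Continuous.integrable_of_hasCompactSupport ?_ ?_) _
        · have := continuous_deriv_deriv_smoothHinge
          fun_prop
        · refine HasCompactSupport.mul_left ?_
          refine HasCompactSupport.intro (isCompact_Icc (a := t - δ) (b := t + 2 * δ))
            fun x hx => ?_
          by_contra h
          have h' : deriv (deriv smoothHinge) ((x - t) / δ) ≠ 0 := fun h' => h (by rw [h', zero_div])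
          have := support_deriv_deriv_smoothHinge h'
          rw [mem_Ioc, lt_div_iff₀ hδ, div_le_iff₀ hδ] at this
          exact hx ⟨by linarith [this.1], by linarith [this.2]⟩
    rw [← h_integral]
    -- The normalization makes the test function admissible, and its factor tends to 1 with `δ → 0`.
    refine le_iSup₂_of_le (fun x => (1 + C * δ)⁻¹ * ψ δ x) (contDiff_const.mul (hsmooth δ)) ?_
    refine le_iSup₂_of_le (hcomp δ hδ).mul_left (fun t => ?_) le_rfl
    rw [abs_mul, abs_of_pos (inv_pos.2 hpos), inv_mul_le_iff₀ hpos, mul_one]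
    exact hbound δ hδ t
  have hlim : Tendsto (fun δ => ENNReal.ofReal ((1 + C * δ)⁻¹ *
      ∑ t ∈ c.support, c t * ∫ x, f x * (deriv (deriv smoothHinge) ((x - t) / δ) / δ)))
      (𝓝[>] 0) (𝓝 (ENNReal.ofReal ((1 + C * 0)⁻¹ * ∑ t ∈ c.support, c t * f t))) := by
    refine ENNReal.tendsto_ofReal (Tendsto.mul ?_ (tendsto_finsetSum _ fun t _ =>
      (tendsto_integral_mul_deriv_deriv_smoothHinge hf t).const_mul _))
    refine Tendsto.mono_left ?_ nhdsWithin_le_nhds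
    have hk : ContinuousAt (fun δ : ℝ => (1 + C * δ)⁻¹) 0 :=
      ContinuousAt.inv₀ (by fun_prop) (by simp)
    exact hk
  simp only [mul_zero, add_zero, inv_one, one_mul] at hlim
  refine le_of_tendsto hlim ?_
  filter_upwards [self_mem_nhdsWithin] with δ hδ using hle δ hδ

/-! ### Total variation of a list of slopes -/

/-- The total variation of a finite sequence. -/
def listVariation : List ℝ → ℝ
  | [] => 0
  | [_] => 0
  | a :: b :: l => |b - a| + listVariation (b :: l)

/-- The slope of the chord of `f` over the interval with end points `I.1` and `I.2`. -/
noncomputable def chordSlope (f : ℝ → ℝ) (I : ℝ × ℝ) : ℝ := (f I.2 - f I.1) / (I.2 - I.1)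

/-- The variation of the chord slopes over successive intervals is at most `TV⁽²⁾(f)`. -/
theorem ofReal_listVariation_chordSlope_le_TV2 {f : ℝ → ℝ} (hf : Continuous f)
    (l : List (ℝ × ℝ)) (hl : ∀ I ∈ l, I.1 < I.2) (hchain : l.IsChain fun I J => I.2 ≤ J.1) :
    ENNReal.ofReal (listVariation (l.map (chordSlope f))) ≤ TV2 f := by
  -- The associated sum of hinges climbs from 0 to 1 across `I`, and its pairing with `f` is minus
  -- the chord slope.
  let ramp : ℝ × ℝ → ℝ →₀ ℝ := fun I =>
    (I.2 - I.1)⁻¹ • (Finsupp.single I.1 1 - Finsupp.single I.2 1)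
  let hinge : ℝ → (ℝ →₀ ℝ) →ₗ[ℝ] ℝ := fun x =>
    Finsupp.linearCombination ℝ fun t : ℝ => max (x - t) 0
  have hramp : ∀ I : ℝ × ℝ, ∀ g : ℝ → ℝ, Finsupp.linearCombination ℝ g (ramp I) =
      (I.2 - I.1)⁻¹ * (g I.1 - g I.2) := fun I g => by
    simp [ramp, Finsupp.linearCombination_single]
  have hrampf : ∀ I : ℝ × ℝ, Finsupp.linearCombination ℝ f (ramp I) = -chordSlope f I :=
    fun I => by rw [hramp, chordSlope]; ring
  have hU : ∀ I : ℝ × ℝ, I.1 < I.2 → ∀ x, hinge x (ramp I) =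
      max 0 (min 1 ((x - I.1) / (I.2 - I.1))) := by
    intro I hI x
    have hd : 0 < I.2 - I.1 := sub_pos.2 hI
    simp only [hinge]
    rw [hramp]
    rcases le_total x I.1 with h | h
    · rw [max_eq_right (by linarith : x - I.1 ≤ 0), max_eq_right (by linarith : x - I.2 ≤ 0),
        min_eq_right, max_eq_left]
      · simp
      · exact div_nonpos_of_nonpos_of_nonneg (by linarith) hd.le
      · exact (div_nonpos_of_nonpos_of_nonneg (by linarith) hd.le).trans zero_le_one
    rcases le_total x I.2 with h2 | h2
    · rw [max_eq_left (by linarith : 0 ≤ x - I.1), max_eq_right (by linarith : x - I.2 ≤ 0),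
        min_eq_right ((div_le_one hd).2 (by linarith)),
        max_eq_right (div_nonneg (by linarith) hd.le)]
      field_simp
      ring
    · rw [max_eq_left (by linarith : 0 ≤ x - I.1), max_eq_left (by linarith : 0 ≤ x - I.2),
        min_eq_left ((one_le_div hd).2 (by linarith)), max_eq_right zero_le_one]
      field_simp
      ring
  have hanti : ∀ I J : ℝ × ℝ, I.1 < I.2 → J.1 < J.2 → I.2 ≤ J.1 → ∀ x,
      hinge x (ramp J) ≤ hinge x (ramp I) := by
    intro I J hI hJ hIJ x
    rw [hU I hI, hU J hJ]
    rcases le_total x J.1 with h | h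
    · have : (x - J.1) / (J.2 - J.1) ≤ 0 :=
        div_nonpos_of_nonpos_of_nonneg (by linarith) (by linarith)
      rw [max_eq_left ((min_le_right _ _).trans this)]
      exact le_max_left _ _
    · have : 1 ≤ (x - I.1) / (I.2 - I.1) := (one_le_div (by linarith)).2 (by linarith)
      rw [min_eq_left this]
      exact max_le_max le_rfl (min_le_left _ _)
  -- Signed differences of consecutive ramps are summed. Bounding by the ramp of the head, rather
  -- than by 1, lets the induction close: ramps decrease along the list, so the bounds telescope.
  have key : ∀ (l : List (ℝ × ℝ)) (I : ℝ × ℝ), (∀ J ∈ I :: l, J.1 < J.2) →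
      (I :: l).IsChain (fun I J => I.2 ≤ J.1) → ∃ c : ℝ →₀ ℝ,
        Finsupp.linearCombination ℝ (fun _ => (1 : ℝ)) c = 0 ∧
        Finsupp.linearCombination ℝ (fun t : ℝ => t) c = 0 ∧
        Finsupp.linearCombination ℝ f c = listVariation ((I :: l).map (chordSlope f)) ∧
        ∀ x, |hinge x c| ≤ hinge x (ramp I) := by
    intro l
    induction l with
    | nil =>
      intro I hI _
      refine ⟨0, by simp, by simp, by simp [listVariation], fun x => ?_⟩
      rw [map_zero, abs_zero, hU I (hI I (by simp))]
      exact le_max_left _ _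
    | cons J l ih =>
      intro I hI hch
      rw [List.isChain_cons_cons] at hch
      obtain ⟨c, c0, c1, cf, cx⟩ := ih J (fun K hK => hI K (by simp [hK])) hch.2
      have hI' := hI I (by simp)
      have hJ' := hI J (by simp)
      obtain ⟨ε, hε, hεs⟩ : ∃ ε : ℝ, |ε| = 1 ∧ ε * (chordSlope f J - chordSlope f I) =
          |chordSlope f J - chordSlope f I| := by
        rcases le_total 0 (chordSlope f J - chordSlope f I) with h | h
        · exact ⟨1, by simp, by rw [abs_of_nonneg h, one_mul]⟩
        · exact ⟨-1, by simp, by rw [abs_of_nonpos h]; ring⟩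
      refine ⟨ε • (ramp I - ramp J) + c, ?_, ?_, ?_, fun x => ?_⟩
      · simp [hramp, c0]
      · have : ∀ K : ℝ × ℝ, K.1 < K.2 → (K.2 - K.1)⁻¹ * (K.1 - K.2) = -1 := fun K hK => by
          rw [← neg_sub K.2 K.1, mul_neg, inv_mul_cancel₀ (sub_pos.2 hK).ne']
        simp [hramp, c1, this I hI', this J hJ']
      · simp only [map_add, map_smul, map_sub, hrampf, cf, List.map_cons, listVariation,
          smul_eq_mul, ← hεs]
        ring
      · simp only [map_add, map_smul, map_sub, smul_eq_mul]
        refine (abs_add_le _ _).trans ?_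
        rw [abs_mul, hε, one_mul, abs_of_nonneg (sub_nonneg.2 (hanti I J hI' hJ' hch.1 x))]
        linarith [cx x]
  cases l with
  | nil => simp [listVariation]
  | cons I l =>
    obtain ⟨c, c0, c1, cf, cx⟩ := key l I hl hchain
    rw [← cf]
    refine ofReal_linearCombination_le_TV2 hf c c0 c1 fun x => (cx x).trans ?_
    rw [hU I (hl I (by simp))]
    exact max_le zero_le_one (min_le_left _ _)

/-! ### Upper bound for the second-order total variation of a piecewise-linear function -/

theorem integrable_mul_deriv_deriv {φ : ℝ → ℝ} (hφ : ContDiff ℝ ∞ φ) (hc : HasCompactSupport φ)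
    {f : ℝ → ℝ} (hf : Continuous f) :
    Integrable fun t => f t * deriv (deriv φ) t := by
  have h2 : Continuous (deriv (deriv φ)) :=
    (contDiff_infty_iff_deriv.1 (contDiff_infty_iff_deriv.1 hφ).2).2.continuous
  exact (hf.mul h2).integrable_of_hasCompactSupport hc.deriv.deriv.mul_left

/-- This primitive replaces two integrations by parts. -/
theorem hasDerivAt_affine_mul_deriv_sub {φ : ℝ → ℝ} (hφ : ContDiff ℝ ∞ φ) (α β t : ℝ) :
    HasDerivAt (fun t => (α + β * t) * deriv φ t - β * φ t) ((α + β * t) * deriv (deriv φ) t) t := by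
  have h1 : HasDerivAt φ (deriv φ t) t := (hφ.differentiable (by simp) t).hasDerivAt
  have h2 : HasDerivAt (deriv φ) (deriv (deriv φ) t) t :=
    ((contDiff_infty_iff_deriv.1 hφ).2.differentiable (by simp) t).hasDerivAt
  have h3 : HasDerivAt (fun t => α + β * t) β t := by
    simpa using ((hasDerivAt_id t).const_mul β).const_add α
  refine ((h3.mul h2).sub (h1.const_mul β)).congr_deriv ?_
  ring

theorem integral_affine_mul_deriv_deriv {φ : ℝ → ℝ} (hφ : ContDiff ℝ ∞ φ) (hc : HasCompactSupport φ)
    (α β : ℝ) :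
    ∫ t, (α + β * t) * deriv (deriv φ) t = 0 := by
  refine integral_eq_zero_of_hasDerivAt_of_integrable
    (hasDerivAt_affine_mul_deriv_sub hφ α β)
    (integrable_mul_deriv_deriv hφ hc (by fun_prop)) ?_
  have h1 : Continuous (deriv φ) := (contDiff_infty_iff_deriv.1 hφ).2.continuous
  have h0 := hφ.continuous
  exact Continuous.integrable_of_hasCompactSupport (by fun_prop) (hc.deriv.mul_left.sub hc.mul_left)

/-- In distributional terms, the second derivative of a hinge is the Dirac mass at its knot. -/
theorem integral_hinge_mul_deriv_deriv {φ : ℝ → ℝ} (hφ : ContDiff ℝ ∞ φ) (hc : HasCompactSupport φ)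
    (a : ℝ) :
    ∫ t, max (t - a) 0 * deriv (deriv φ) t = φ a := by
  have e : (fun t => max (t - a) 0 * deriv (deriv φ) t) =
      (Ioi a).indicator fun t => (-a + 1 * t) * deriv (deriv φ) t := by
    funext t
    by_cases h : t ∈ Ioi a
    · rw [indicator_of_mem h, max_eq_left (by linarith [mem_Ioi.1 h])]
      ring
    · rw [indicator_of_notMem h, max_eq_right (by linarith [not_lt.1 (mt mem_Ioi.2 h)]), zero_mul]
  have hz : ∀ g : ℝ → ℝ, HasCompactSupport g → Tendsto g atTop (𝓝 0) := fun g hg =>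
    hg.is_zero_at_infty.mono_left atTop_le_cocompact
  rw [e, integral_indicator measurableSet_Ioi,
    integral_Ioi_of_hasDerivAt_of_tendsto' (m := 0)
      (fun t _ => hasDerivAt_affine_mul_deriv_sub hφ (-a) 1 t)
      (integrable_mul_deriv_deriv hφ hc (by fun_prop)).integrableOn
      (hz _ (hc.deriv.mul_left.sub hc.mul_left))]
  ring

/-- The second derivative is `∑ wᵢ δ_{aᵢ}`. Only an inequality holds in general, since knots may
coincide and weights cancel. -/
theorem TV2_affine_add_sum_hinge_le {ι : Type*} (s : Finset ι) (α β : ℝ) (w a : ι → ℝ) :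
    TV2 (fun t => α + β * t + ∑ i ∈ s, w i * max (t - a i) 0) ≤
      ENNReal.ofReal (∑ i ∈ s, |w i|) := by
  refine iSup₂_le fun φ hφ => iSup₂_le fun hc hb => ENNReal.ofReal_le_ofReal ?_
  have e : ∀ t, (α + β * t + ∑ i ∈ s, w i * max (t - a i) 0) * deriv (deriv φ) t =
      (α + β * t) * deriv (deriv φ) t +
        ∑ i ∈ s, w i * (max (t - a i) 0 * deriv (deriv φ) t) := by
    intro t
    rw [add_mul, Finset.sum_mul]
    simp only [mul_assoc]
  have hi : ∀ i ∈ s, Integrable fun t => w i * (max (t - a i) 0 * deriv (deriv φ) t) :=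
    fun i _ => (integrable_mul_deriv_deriv hφ hc (by fun_prop)).const_mul _
  simp only [e]
  rw [integral_add (integrable_mul_deriv_deriv hφ hc (by fun_prop)) (integrable_finsetSum _ hi),
    integral_affine_mul_deriv_deriv hφ hc, zero_add, integral_finsetSum _ hi]
  refine Finset.sum_le_sum fun i _ => ?_
  rw [integral_const_mul, integral_hinge_mul_deriv_deriv hφ hc]
  refine (le_abs_self _).trans ?_
  rw [abs_mul]
  exact mul_le_of_le_one_right (abs_nonneg _) (hb _)

theorem TV2_neg (f : ℝ → ℝ) : TV2 (fun t => -f t) = TV2 f := by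
  have h : ∀ f : ℝ → ℝ, TV2 (fun t => -f t) ≤ TV2 f := by
    intro f
    refine iSup₂_le fun φ hφ => iSup₂_le fun hc hb => ?_
    refine le_iSup₂_of_le (fun t => -φ t) hφ.neg ?_
    refine le_iSup₂_of_le hc.neg (by simpa using hb) (le_of_eq ?_)
    simp
  refine le_antisymm (h f) ?_
  simpa using h fun t => -f t

/-! ### Effect on the variation of modifying or inserting terms of a sequence -/

theorem listVariation_nonneg : ∀ l : List ℝ, 0 ≤ listVariation l
  | [] => le_rfl
  | [_] => le_rfl
  | _ :: b :: l => add_nonneg (abs_nonneg _) (listVariation_nonneg (b :: l))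

theorem listVariation_append_cons (a : ℝ) (l : List ℝ) : ∀ u : List ℝ,
    listVariation (u ++ a :: l) = listVariation (u ++ [a]) + listVariation (a :: l)
  | [] => by simp [listVariation]
  | [b] => by simp [listVariation]
  | b :: c :: u => by
    have := listVariation_append_cons a l (c :: u)
    simp only [List.cons_append, listVariation] at this ⊢
    rw [this, add_assoc]

theorem listVariation_concat_concat (u : List ℝ) (c a : ℝ) :
    listVariation (u ++ [c] ++ [a]) = listVariation (u ++ [c]) + |a - c| := by
  rw [List.append_assoc, List.singleton_append, listVariation_append_cons]
  simp [listVariation]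

theorem listVariation_concat_le (u : List ℝ) (a b : ℝ) :
    listVariation (u ++ [a]) ≤ listVariation (u ++ [b]) + |a - b| := by
  rcases List.eq_nil_or_concat' u with rfl | ⟨u, c, rfl⟩
  · simp [listVariation]
  · rw [listVariation_concat_concat, listVariation_concat_concat]
    linarith [abs_sub_le a b c]

theorem listVariation_cons_le (w : List ℝ) (a b : ℝ) :
    listVariation (a :: w) ≤ listVariation (b :: w) + |a - b| := by
  cases w with
  | nil => simp [listVariation]
  | cons c w =>
    simp only [listVariation]
    linarith [abs_sub_le c b a, abs_sub_comm a b]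

/-- The added `m` and `σ` stand for the ascent from a lower preceding term. Without them the
inequality fails, for instance when `w` is empty. -/
theorem listVariation_cons_add_lt {w : List ℝ} {m σ : ℝ} (hm : m < σ) (hw : ∀ c ∈ w, c < σ) :
    listVariation (m :: w) + m < listVariation (σ :: w) + σ := by
  cases w with
  | nil => simpa [listVariation] using hm
  | cons c w =>
    have hc := hw c (by simp)
    simp only [listVariation]
    rw [abs_of_neg (sub_neg.2 hc)]
    have : |c - m| < σ - c + (σ - m) := abs_lt.2 ⟨by linarith, by linarith⟩
    linarith

theorem listVariation_concat_add_lt {u : List ℝ} {m σ : ℝ} (hm : m < σ) (hu : ∀ c ∈ u, c < σ) :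
    listVariation (u ++ [m]) + m < listVariation (u ++ [σ]) + σ := by
  rcases List.eq_nil_or_concat' u with rfl | ⟨u, c, rfl⟩
  · simpa [listVariation] using hm
  · have hc := hu c (by simp)
    rw [listVariation_concat_concat, listVariation_concat_concat, abs_of_pos (sub_pos.2 hc)]
    have : |m - c| < σ - c + (σ - m) := abs_lt.2 ⟨by linarith, by linarith⟩
    linarith

/-- Replacing a slope `m` by a lower `a` and then a higher `σ` is a strict detour as soon as every
later term lies below `σ`: the ascent `σ - a` pays for both changes. -/
theorem listVariation_lt_of_insert_right {u w : List ℝ} {a m σ : ℝ} (ha : a ≤ m) (hm : m < σ)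
    (hw : ∀ c ∈ w, c < σ) :
    listVariation (u ++ m :: w) < listVariation (u ++ a :: σ :: w) := by
  rw [listVariation_append_cons, listVariation_append_cons a]
  have h1 := listVariation_concat_le u m a
  have h2 := listVariation_cons_add_lt hm hw
  rw [abs_of_nonneg (sub_nonneg.2 ha)] at h1
  simp only [listVariation]
  rw [abs_of_pos (by linarith : 0 < σ - a)]
  linarith

theorem listVariation_lt_of_insert_left {u w : List ℝ} {b m σ : ℝ} (hb : b ≤ m) (hm : m < σ)
    (hu : ∀ c ∈ u, c < σ) :
    listVariation (u ++ m :: w) < listVariation (u ++ σ :: b :: w) := by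
  rw [listVariation_append_cons, listVariation_append_cons σ]
  have h1 := listVariation_cons_le w m b
  have h2 := listVariation_concat_add_lt hm hu
  rw [abs_of_nonneg (sub_nonneg.2 hb)] at h1
  simp only [listVariation]
  rw [abs_of_neg (by linarith : b - σ < 0)]
  linarith

theorem listVariation_lt_cons {l : List ℝ} (hl : l ≠ []) {σ : ℝ} (h : ∀ c ∈ l, c < σ) :
    listVariation l < listVariation (σ :: l) := by
  cases l with
  | nil => exact absurd rfl hl
  | cons c l =>
    have := abs_pos.2 (sub_ne_zero.2 (h c (by simp)).ne)
    simp only [listVariation]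
    linarith

theorem listVariation_lt_concat {l : List ℝ} (hl : l ≠ []) {σ : ℝ} (h : ∀ c ∈ l, c < σ) :
    listVariation l < listVariation (l ++ [σ]) := by
  rcases List.eq_nil_or_concat' l with rfl | ⟨u, c, rfl⟩
  · exact absurd rfl hl
  · have := abs_pos.2 (sub_ne_zero.2 (h c (by simp)).ne')
    rw [listVariation_concat_concat]
    linarith

theorem listVariation_map_range (σ : ℕ → ℝ) (N : ℕ) :
    listVariation ((List.range (N + 1)).map σ) = ∑ k ∈ Finset.range N, |σ (k + 1) - σ k| := by
  induction N with
  | zero => simp [listVariation]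
  | succ N ih =>
    rw [Finset.sum_range_succ, ← ih, List.range_succ (n := N + 1), List.map_append,
      List.range_succ (n := N), List.map_append, List.map_singleton, List.map_singleton,
      listVariation_concat_concat]

theorem chordSlope_mul {f : ℝ → ℝ} {s t : ℝ} (h : s < t) :
    chordSlope f (s, t) * (t - s) = f t - f s :=
  div_mul_cancel₀ _ (sub_pos.2 h).ne'

/-! ### Functions whose second-order total variation is that of their slopes -/

/-- Under `hTV` no list of successive intervals has larger slope variation than `l`. The chord
bounds below contradict this by modifying `l`. -/
theorem chordSlope_list_le_of_TV2_le {f : ℝ → ℝ} (hf : Continuous f) {l l' : List (ℝ × ℝ)}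
    (hl : ∀ I ∈ l', I.1 < I.2) (hp : l'.Pairwise fun I J => I.2 ≤ J.1)
    (hTV : TV2 f ≤ ENNReal.ofReal (listVariation (l.map (chordSlope f)))) :
    listVariation (l'.map (chordSlope f)) ≤ listVariation (l.map (chordSlope f)) :=
  (ENNReal.ofReal_le_ofReal_iff (listVariation_nonneg _)).1
    ((ofReal_listVariation_chordSlope_le_TV2 hf l' hl hp.isChain).trans hTV)

/-- A chord of `f` inside one of the intervals. -/
theorem chordSlope_le_of_subinterval {f : ℝ → ℝ} (hf : Continuous f) {L : ℝ}
    {l₁ l₂ : List (ℝ × ℝ)} {I : ℝ × ℝ} (hl : ∀ J ∈ l₁ ++ I :: l₂, J.1 < J.2)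
    (hp : (l₁ ++ I :: l₂).Pairwise fun I J => I.2 ≤ J.1)
    (hL : ∀ J ∈ l₁ ++ I :: l₂, chordSlope f J ≤ L)
    (hTV : TV2 f ≤ ENNReal.ofReal (listVariation ((l₁ ++ I :: l₂).map (chordSlope f))))
    {s t : ℝ} (hs : I.1 ≤ s) (hst : s < t) (ht : t ≤ I.2) : chordSlope f (s, t) ≤ L := by
  by_contra! hσ
  have hI : chordSlope f I ≤ L := hL I (by simp)
  have hII : I.1 < I.2 := hl I (by simp)
  have hlt : ∀ J ∈ l₁ ++ I :: l₂, chordSlope f J < chordSlope f (s, t) := fun J hJ =>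
    (hL J hJ).trans_lt hσ
  have e := chordSlope_mul (f := f) hst
  have eI : chordSlope f I * (I.2 - I.1) = f I.2 - f I.1 := chordSlope_mul hII
  rw [List.pairwise_append, List.pairwise_cons] at hp
  obtain ⟨hp1, ⟨hp2, hp3⟩, hp4⟩ := hp
  -- The slope over `I` is a weighted mean of those over its pieces. As the piece `(s, t)` is
  -- steeper than `I`, some other nondegenerate piece is no steeper than `I`.
  have hcase : (I.1 < s ∧ chordSlope f (I.1, s) ≤ chordSlope f I) ∨
      (t < I.2 ∧ chordSlope f (t, I.2) ≤ chordSlope f I) := by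
    by_contra! h
    have h1 : chordSlope f I * (s - I.1) ≤ f s - f I.1 := by
      rcases hs.eq_or_lt with h' | h'
      · rw [← h']; simp
      · rw [← chordSlope_mul h']
        exact mul_le_mul_of_nonneg_right (h.1 h').le (by linarith)
    have h2 : chordSlope f I * (I.2 - t) ≤ f I.2 - f t := by
      rcases ht.eq_or_lt with h' | h'
      · rw [← h']; simp
      · rw [← chordSlope_mul h']
        exact mul_le_mul_of_nonneg_right (h.2 h').le (by linarith)
    have h3 : chordSlope f I * (t - s) < f t - f s := by
      rw [← e]
      exact mul_lt_mul_of_pos_right (by linarith) (by linarith)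
    nlinarith
  rcases hcase with ⟨h, ha⟩ | ⟨h, hb⟩
  -- The remaining piece from `t` to `I.2` has uncontrolled slope and is dropped; successive
  -- intervals may leave gaps.
  · refine (chordSlope_list_le_of_TV2_le hf (l' := l₁ ++ (I.1, s) :: (s, t) :: l₂) ?_ ?_
      hTV).not_gt ?_
    · simp only [List.mem_append, List.mem_cons] at hl ⊢
      rintro J (hJ | rfl | rfl | hJ)
      exacts [hl J (Or.inl hJ), h, hst, hl J (Or.inr (Or.inr hJ))]
    · simp only [List.pairwise_append, List.pairwise_cons, List.mem_cons] at hp4 ⊢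
      refine ⟨hp1, ⟨?_, fun J hJ => ht.trans (hp2 J hJ), hp3⟩, ?_⟩
      · rintro J (rfl | hJ)
        exacts [le_rfl, (hst.le.trans ht).trans (hp2 J hJ)]
      · rintro K hK J (rfl | rfl | hJ)
        exacts [hp4 K hK I (Or.inl rfl), (hp4 K hK I (Or.inl rfl)).trans hs,
          hp4 K hK J (Or.inr hJ)]
    · simp only [List.map_append, List.map_cons]
      refine listVariation_lt_of_insert_right ha (by linarith) fun c hc => ?_
      obtain ⟨J, hJ, rfl⟩ := List.mem_map.1 hc
      exact hlt J (by simp [hJ])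
  · refine (chordSlope_list_le_of_TV2_le hf (l' := l₁ ++ (s, t) :: (t, I.2) :: l₂) ?_ ?_
      hTV).not_gt ?_
    · simp only [List.mem_append, List.mem_cons] at hl ⊢
      rintro J (hJ | rfl | rfl | hJ)
      exacts [hl J (Or.inl hJ), hst, h, hl J (Or.inr (Or.inr hJ))]
    · simp only [List.pairwise_append, List.pairwise_cons, List.mem_cons] at hp4 ⊢
      refine ⟨hp1, ⟨?_, fun J hJ => hp2 J hJ, hp3⟩, ?_⟩
      · rintro J (rfl | hJ)
        exacts [le_rfl, ht.trans (hp2 J hJ)]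
      · rintro K hK J (rfl | rfl | hJ)
        exacts [(hp4 K hK I (Or.inl rfl)).trans hs,
          (hp4 K hK I (Or.inl rfl)).trans (hs.trans hst.le), hp4 K hK J (Or.inr hJ)]
    · simp only [List.map_append, List.map_cons]
      refine listVariation_lt_of_insert_left hb (by linarith) fun c hc => ?_
      obtain ⟨J, hJ, rfl⟩ := List.mem_map.1 hc
      exact hlt J (by simp [hJ])

/-- A chord of `f` to the left of all the intervals. -/
theorem chordSlope_le_of_le_head {f : ℝ → ℝ} (hf : Continuous f) {L : ℝ}
    {l : List (ℝ × ℝ)} (hne : l ≠ []) (hl : ∀ J ∈ l, J.1 < J.2)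
    (hp : l.Pairwise fun I J => I.2 ≤ J.1) (hL : ∀ J ∈ l, chordSlope f J ≤ L)
    (hTV : TV2 f ≤ ENNReal.ofReal (listVariation (l.map (chordSlope f))))
    {s t : ℝ} (hst : s < t) (ht : ∀ J ∈ l, t ≤ J.1) : chordSlope f (s, t) ≤ L := by
  by_contra! hσ
  refine (chordSlope_list_le_of_TV2_le hf (l' := (s, t) :: l) ?_ ?_ hTV).not_gt ?_
  · rintro J hJ
    rcases List.mem_cons.1 hJ with rfl | hJ
    exacts [hst, hl J hJ]
  · exact List.pairwise_cons.2 ⟨ht, hp⟩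
  · rw [List.map_cons]
    refine listVariation_lt_cons (by simpa using hne) fun c hc => ?_
    obtain ⟨J, hJ, rfl⟩ := List.mem_map.1 hc
    exact (hL J hJ).trans_lt hσ

/-- A chord of `f` to the right of all the intervals. -/
theorem chordSlope_le_of_getLast_le {f : ℝ → ℝ} (hf : Continuous f) {L : ℝ}
    {l : List (ℝ × ℝ)} (hne : l ≠ []) (hl : ∀ J ∈ l, J.1 < J.2)
    (hp : l.Pairwise fun I J => I.2 ≤ J.1) (hL : ∀ J ∈ l, chordSlope f J ≤ L)
    (hTV : TV2 f ≤ ENNReal.ofReal (listVariation (l.map (chordSlope f))))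
    {s t : ℝ} (hst : s < t) (hs : ∀ J ∈ l, J.2 ≤ s) : chordSlope f (s, t) ≤ L := by
  by_contra! hσ
  refine (chordSlope_list_le_of_TV2_le hf (l' := l ++ [(s, t)]) ?_ ?_ hTV).not_gt ?_
  · rintro J hJ
    rcases List.mem_append.1 hJ with hJ | hJ
    · exact hl J hJ
    · rw [List.mem_singleton.1 hJ]
      exact hst
  · refine List.pairwise_append.2 ⟨hp, List.pairwise_singleton _ _, fun I hI J hJ => ?_⟩
    rw [List.mem_singleton.1 hJ]
    exact hs I hI
  · rw [List.map_append, List.map_singleton]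
    refine listVariation_lt_concat (by simpa using hne) fun c hc => ?_
    obtain ⟨J, hJ, rfl⟩ := List.mem_map.1 hc
    exact (hL J hJ).trans_lt hσ

/-- The successive intervals between the first `n + 1` terms of a sequence. -/
def successiveIntervals (X : ℕ → ℝ) (n : ℕ) : List (ℝ × ℝ) :=
  (List.range n).map fun k => (X k, X (k + 1))

theorem mem_successiveIntervals {X : ℕ → ℝ} {n : ℕ} {J : ℝ × ℝ} :
    J ∈ successiveIntervals X n ↔ ∃ k < n, (X k, X (k + 1)) = J := by
  simp [successiveIntervals]

theorem le_of_forall_lt_succ {X : ℕ → ℝ} {n : ℕ} (hX : ∀ k < n, X k < X (k + 1)) {i j : ℕ}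
    (hij : i ≤ j) (hj : j ≤ n) : X i ≤ X j := by
  induction j, hij using Nat.le_induction with
  | base => exact le_rfl
  | succ j _ ih => exact (ih (by omega)).trans (hX j (by omega)).le

theorem pairwise_successiveIntervals {X : ℕ → ℝ} {n : ℕ} (hX : ∀ k < n, X k < X (k + 1)) :
    (successiveIntervals X n).Pairwise fun I J => I.2 ≤ J.1 := by
  rw [successiveIntervals, List.pairwise_map]
  refine List.pairwise_lt_range.imp_of_mem fun {i j} _ hj h => ?_
  exact le_of_forall_lt_succ hX h (List.mem_range.1 hj).le

/-- The chord bounds treat one piece of the line at a time. Restated as antitonicity of `f t - L *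
t`, they glue at the nodes. At least one interval is needed: an affine function has zero `TV2`
whatever its slope. -/
theorem sub_le_mul_of_TV2_le {f : ℝ → ℝ} (hf : Continuous f) {X : ℕ → ℝ} {n : ℕ}
    (hX : ∀ k < n, X k < X (k + 1)) (hn : 1 ≤ n) {L : ℝ}
    (hL : ∀ k < n, chordSlope f (X k, X (k + 1)) ≤ L)
    (hTV : TV2 f ≤ ENNReal.ofReal (listVariation
      ((successiveIntervals X n).map (chordSlope f)))) {s t : ℝ} (hst : s ≤ t) :
    f t - f s ≤ L * (t - s) := by
  have hne : successiveIntervals X n ≠ [] := by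
    simpa [successiveIntervals] using Nat.one_le_iff_ne_zero.1 hn
  have hl : ∀ J ∈ successiveIntervals X n, J.1 < J.2 := fun J hJ => by
    obtain ⟨k, hk, rfl⟩ := mem_successiveIntervals.1 hJ
    exact hX k hk
  have hp := pairwise_successiveIntervals hX
  have hL' : ∀ J ∈ successiveIntervals X n, chordSlope f J ≤ L := fun J hJ => by
    obtain ⟨k, hk, rfl⟩ := mem_successiveIntervals.1 hJ
    exact hL k hk
  have anti : ∀ S : Set ℝ, (∀ s ∈ S, ∀ t ∈ S, s < t → chordSlope f (s, t) ≤ L) →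
      AntitoneOn (fun t => f t - L * t) S := by
    intro S hS s hs t ht hst
    rcases hst.eq_or_lt with rfl | h
    · exact le_rfl
    have h1 := hS s hs t ht h
    have h2 := chordSlope_mul (f := f) h
    have h3 := mul_le_mul_of_nonneg_right h1 (sub_pos.2 h).le
    show f t - L * t ≤ f s - L * s
    linarith
  have hleft : ∀ k ≤ n, AntitoneOn (fun t => f t - L * t) (Iic (X k)) := by
    intro k
    induction k with
    | zero =>
      intro _
      refine anti _ fun s _ t ht h => chordSlope_le_of_le_head hf hne hl hp hL' hTV h ?_
      intro J hJ
      obtain ⟨k, hk, rfl⟩ := mem_successiveIntervals.1 hJ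
      exact (mem_Iic.1 ht).trans (le_of_forall_lt_succ hX (Nat.zero_le k) hk.le)
    | succ k ih =>
      intro hk
      have hmem : (X k, X (k + 1)) ∈ successiveIntervals X n :=
        mem_successiveIntervals.2 ⟨k, hk, rfl⟩
      obtain ⟨l₁, l₂, hsplit⟩ := List.append_of_mem hmem
      have hmid : AntitoneOn (fun t => f t - L * t) (Icc (X k) (X (k + 1))) := by
        rw [hsplit] at hl hp hL' hTV
        exact anti _ fun s hs t ht h =>
          chordSlope_le_of_subinterval hf hl hp hL' hTV hs.1 h ht.2
      rw [← Iic_union_Icc_eq_Iic (hX k hk).le]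
      exact (ih (by omega)).union_right hmid isGreatest_Iic (isLeast_Icc (hX k hk).le)
  have hright : AntitoneOn (fun t => f t - L * t) (Ici (X n)) := by
    refine anti _ fun s hs t _ h => chordSlope_le_of_getLast_le hf hne hl hp hL' hTV h ?_
    intro J hJ
    obtain ⟨k, hk, rfl⟩ := mem_successiveIntervals.1 hJ
    exact (le_of_forall_lt_succ hX (j := n) hk le_rfl).trans hs
  have h := AntitoneOn.Iic_union_Ici (hleft n le_rfl) hright hst
  simp only at h
  linarith

theorem chordSlope_neg (f : ℝ → ℝ) (I : ℝ × ℝ) :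
    chordSlope (fun t => -f t) I = -chordSlope f I := by
  simp only [chordSlope]
  ring

theorem listVariation_map_neg : ∀ l : List ℝ, listVariation (l.map Neg.neg) = listVariation l
  | [] => rfl
  | [_] => rfl
  | a :: b :: l => by
    have := listVariation_map_neg (b :: l)
    simp only [List.map_cons, listVariation] at this ⊢
    rw [this, neg_sub_neg, abs_sub_comm]

/-- If `TV⁽²⁾(f)` does not exceed the variation of the slopes of `f` over successive intervals,
then the Lipschitz constant of `f` is at most the largest modulus of these slopes. -/
theorem abs_sub_le_mul_of_TV2_le {f : ℝ → ℝ} (hf : Continuous f) {X : ℕ → ℝ} {n : ℕ}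
    (hX : ∀ k < n, X k < X (k + 1)) (hn : 1 ≤ n) {L : ℝ}
    (hL : ∀ k < n, |chordSlope f (X k, X (k + 1))| ≤ L)
    (hTV : TV2 f ≤ ENNReal.ofReal (listVariation
      ((successiveIntervals X n).map (chordSlope f)))) (s t : ℝ) :
    |f s - f t| ≤ L * |s - t| := by
  have key : ∀ s t, s ≤ t → |f s - f t| ≤ L * |s - t| := by
    intro s t hst
    have h1 := sub_le_mul_of_TV2_le hf hX hn (fun k hk => (abs_le.1 (hL k hk)).2) hTV hst
    have hmap : (successiveIntervals X n).map (chordSlope fun t => -f t) =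
        ((successiveIntervals X n).map (chordSlope f)).map Neg.neg := by
      simp [Function.comp_def, chordSlope_neg]
    have h2 := sub_le_mul_of_TV2_le (f := fun t => -f t) hf.neg hX hn (L := L)
      (fun k hk => by
        have := (abs_le.1 (hL k hk)).1
        rw [chordSlope_neg]
        linarith)
      (by rw [TV2_neg, hmap, listVariation_map_neg]; exact hTV) hst
    rw [abs_sub_comm s t, abs_of_nonneg (sub_nonneg.2 hst), abs_le]
    constructor <;> linarith
  rcases le_total s t with h | h
  · exact key s t h
  · rw [abs_sub_comm, abs_sub_comm s]
    exact key t s h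

/-! ### The piecewise-linear interpolant -/

/-- The slopes between successive points. -/
noncomputable def successiveSlope (X Z : ℕ → ℝ) (k : ℕ) : ℝ :=
  (Z (k + 1) - Z k) / (X (k + 1) - X k)

/-- The piecewise-linear interpolant of the points `(X k, Z k)`, `k ≤ N + 1`, with knots at the
interior points only. -/
noncomputable def linearSpline (X Z : ℕ → ℝ) (N : ℕ) (t : ℝ) : ℝ :=
  Z 0 - successiveSlope X Z 0 * X 0 + successiveSlope X Z 0 * t +
    ∑ k ∈ Finset.range N,
      (successiveSlope X Z (k + 1) - successiveSlope X Z k) * max (t - X (k + 1)) 0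

theorem linearSpline_apply {X : ℕ → ℝ} (Z : ℕ → ℝ) {N : ℕ}
    (hX : ∀ k < N + 1, X k < X (k + 1)) {m : ℕ} (hm : m ≤ N + 1) :
    linearSpline X Z N (X m) = Z m := by
  induction m with
  | zero =>
    have : ∑ k ∈ Finset.range N, (successiveSlope X Z (k + 1) - successiveSlope X Z k) *
        max (X 0 - X (k + 1)) 0 = 0 := by
      refine Finset.sum_eq_zero fun k hk => ?_
      have := le_of_forall_lt_succ hX (Nat.zero_le (k + 1))
        (by have := Finset.mem_range.1 hk; omega)
      rw [max_eq_right (by linarith), mul_zero]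
    rw [linearSpline, this]
    ring
  | succ m ih =>
    have hm' := hX m hm
    have e : linearSpline X Z N (X (m + 1)) - linearSpline X Z N (X m) =
        successiveSlope X Z m * (X (m + 1) - X m) := by
      -- Between consecutive nodes exactly the hinges with `k < m` are active, and their slope jumps
      -- telescope.
      have h1 : ∀ k ∈ Finset.range N, (successiveSlope X Z (k + 1) - successiveSlope X Z k) *
          max (X (m + 1) - X (k + 1)) 0 -
          (successiveSlope X Z (k + 1) - successiveSlope X Z k) * max (X m - X (k + 1)) 0 =
          if k < m then (successiveSlope X Z (k + 1) - successiveSlope X Z k) *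
            (X (m + 1) - X m) else 0 := by
        intro k hk
        have hk' := Finset.mem_range.1 hk
        split_ifs with h
        · have := le_of_forall_lt_succ hX (i := k + 1) (j := m) h (by omega)
          rw [max_eq_left (by linarith), max_eq_left (by linarith)]
          ring
        · have := le_of_forall_lt_succ hX (i := m + 1) (j := k + 1) (by omega) (by omega)
          rw [max_eq_right (by linarith), max_eq_right (by linarith)]
          ring
      have h2 : (Finset.range N).filter (· < m) = Finset.range m := by
        ext k
        simp only [Finset.mem_filter, Finset.mem_range]
        omega
      have h3 : ∑ k ∈ Finset.range N, (successiveSlope X Z (k + 1) - successiveSlope X Z k) *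
          max (X (m + 1) - X (k + 1)) 0 -
          ∑ k ∈ Finset.range N, (successiveSlope X Z (k + 1) - successiveSlope X Z k) *
            max (X m - X (k + 1)) 0 =
          (successiveSlope X Z m - successiveSlope X Z 0) * (X (m + 1) - X m) := by
        rw [← Finset.sum_sub_distrib, Finset.sum_congr rfl h1, ← Finset.sum_filter, h2,
          ← Finset.sum_mul, Finset.sum_range_sub]
      simp only [linearSpline]
      linarith
    rw [ih (by omega), successiveSlope, div_mul_cancel₀ _ (sub_pos.2 hm').ne'] at e
    linarith

theorem map_chordSlope_successiveIntervals {f : ℝ → ℝ} {X Z : ℕ → ℝ} {n : ℕ}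
    (hf : ∀ k ≤ n, f (X k) = Z k) :
    (successiveIntervals X n).map (chordSlope f) = (List.range n).map (successiveSlope X Z) := by
  rw [successiveIntervals, List.map_map]
  refine List.map_congr_left fun k hk => ?_
  have hk' := List.mem_range.1 hk
  simp [chordSlope, successiveSlope, hf k hk'.le, hf (k + 1) hk']

/-- The hinge weights are the jumps between consecutive slopes; the end pieces extend affinely and
add nothing. -/
theorem TV2_linearSpline_le (X Z : ℕ → ℝ) (N : ℕ) :
    TV2 (linearSpline X Z N) ≤
      ENNReal.ofReal (listVariation ((List.range (N + 1)).map (successiveSlope X Z))) := by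
  rw [listVariation_map_range]
  exact TV2_affine_add_sum_hinge_le _ _ _ _ _

/-! ### Continuous piecewise-linear functions -/

theorem isCPWL_affine (a b : ℝ) : IsCPWL fun t => a + b * t :=
  ⟨by fun_prop, ∅, fun _ _ _ => ⟨b, a, fun _ _ => add_comm _ _⟩⟩

theorem isCPWL_hinge (w a : ℝ) : IsCPWL fun t => w * max (t - a) 0 := by
  refine ⟨by fun_prop, {a}, fun I hI hd => ?_⟩
  have ha : a ∉ I := fun h => (Set.disjoint_left.1 hd h) (by simp)
  by_cases h : ∃ t ∈ I, a < t
  · obtain ⟨t, ht, hat⟩ := h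
    refine ⟨w, -(w * a), fun u hu => ?_⟩
    have : a ≤ u := by
      by_contra! h'
      exact ha (hI.out hu ht ⟨h'.le, hat.le⟩)
    beta_reduce
    rw [max_eq_left (by linarith)]
    ring
  · push Not at h
    refine ⟨0, 0, fun u hu => ?_⟩
    beta_reduce
    rw [max_eq_right (by linarith [h u hu])]
    ring

theorem IsCPWL.add {f g : ℝ → ℝ} (hf : IsCPWL f) (hg : IsCPWL g) :
    IsCPWL fun t => f t + g t := by
  classical
  obtain ⟨cf, S, hS⟩ := hf
  obtain ⟨cg, T, hT⟩ := hg
  refine ⟨cf.add cg, S ∪ T, fun I hI hd => ?_⟩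
  rw [Finset.coe_union, Set.disjoint_union_right] at hd
  obtain ⟨a, b, hab⟩ := hS I hI hd.1
  obtain ⟨c, d, hcd⟩ := hT I hI hd.2
  refine ⟨a + c, b + d, fun t ht => ?_⟩
  beta_reduce
  rw [hab t ht, hcd t ht]
  ring

theorem isCPWL_linearSpline (X Z : ℕ → ℝ) (N : ℕ) : IsCPWL (linearSpline X Z N) := by
  refine (isCPWL_affine _ _).add ?_
  induction N with
  | zero => simpa using isCPWL_affine 0 0
  | succ N ih =>
    simp only [Finset.sum_range_succ]
    exact ih.add (isCPWL_hinge _ _)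

/-! ### The Lipschitz constant -/

theorem abs_sub_le_lipConst_mul {f : ℝ → ℝ} (hf : f ∈ LipR) (s t : ℝ) :
    |f s - f t| ≤ lipConst f * |s - t| := by
  rcases eq_or_ne s t with rfl | hst
  · simp
  have hpos : 0 < |s - t| := abs_pos.2 (sub_ne_zero.2 hst)
  rw [← div_le_iff₀ hpos]
  obtain ⟨K, hK⟩ := hf
  refine le_ciSup (f := fun p : {p : ℝ × ℝ // p.1 ≠ p.2} =>
    |f p.1.1 - f p.1.2| / |p.1.1 - p.1.2|) ⟨K, ?_⟩ ⟨(s, t), hst⟩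
  rintro _ ⟨p, rfl⟩
  have hp : 0 < |p.1.1 - p.1.2| := abs_pos.2 (sub_ne_zero.2 p.2)
  exact (div_le_iff₀ hp).2 (by simpa [Real.dist_eq] using hK.dist_le_mul p.1.1 p.1.2)

theorem nonneg_of_abs_sub_le {f : ℝ → ℝ} {K : ℝ} (h : ∀ s t, |f s - f t| ≤ K * |s - t|) :
    0 ≤ K := by
  simpa using (abs_nonneg _).trans (h 1 0)

theorem lipConst_le {f : ℝ → ℝ} {K : ℝ} (h : ∀ s t, |f s - f t| ≤ K * |s - t|) :
    lipConst f ≤ K :=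
  Real.iSup_le (fun p => (div_le_iff₀ (abs_pos.2 (sub_ne_zero.2 p.2))).2 (h _ _))
    (nonneg_of_abs_sub_le h)

theorem lipschitzWith_of_abs_sub_le {f : ℝ → ℝ} {K : ℝ}
    (h : ∀ s t, |f s - f t| ≤ K * |s - t|) : LipschitzWith K.toNNReal f :=
  LipschitzWith.of_dist_le_mul fun s t => by
    simpa [Real.dist_eq, Real.coe_toNNReal _ (nonneg_of_abs_sub_le h)] using h s t

theorem mem_LipR_of_abs_sub_le {f : ℝ → ℝ} {K : ℝ} (h : ∀ s t, |f s - f t| ≤ K * |s - t|) :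
    f ∈ LipR :=
  ⟨_, lipschitzWith_of_abs_sub_le h⟩

/-- Lipschitz extension of a function given on a family of abscissas. -/
theorem exists_lipschitz_through {ι : Type*} (P : ι → ℝ × ℝ) {K : ℝ} (hK : 0 ≤ K)
    (hP : ∀ i j, |(P i).2 - (P j).2| ≤ K * |(P i).1 - (P j).1|) :
    ∃ f : ℝ → ℝ, (∀ s t, |f s - f t| ≤ K * |s - t|) ∧ ∀ i, f (P i).1 = (P i).2 := by
  classical
  let f₀ : ℝ → ℝ := fun t => if h : ∃ i, (P i).1 = t then (P h.choose).2 else 0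
  have hf₀ : ∀ i, f₀ (P i).1 = (P i).2 := by
    intro i
    have h : ∃ j, (P j).1 = (P i).1 := ⟨i, rfl⟩
    -- Indices sharing an abscissa share their ordinate, so the choice is harmless and `P` need not
    -- have distinct abscissas.
    have h1 := hP h.choose i
    rw [h.choose_spec, sub_self, abs_zero, mul_zero] at h1
    simp only [f₀, dif_pos h]
    exact sub_eq_zero.1 (abs_nonpos_iff.1 h1)
  have hlip : LipschitzOnWith K.toNNReal f₀ (range fun i => (P i).1) := by
    refine LipschitzOnWith.of_dist_le_mul ?_
    rintro _ ⟨i, rfl⟩ _ ⟨j, rfl⟩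
    simpa [Real.dist_eq, hf₀, Real.coe_toNNReal _ hK] using hP i j
  obtain ⟨g, hg, hgf⟩ := hlip.extend_real
  refine ⟨g, fun s t => ?_, fun i => ?_⟩
  · simpa [Real.dist_eq, Real.coe_toNNReal _ hK] using hg.dist_le_mul s t
  · rw [← hgf ⟨i, rfl⟩, hf₀]

/-! ### The largest slope -/

section MaxSlope

variable {n : ℕ} {x : Fin (n + 1) → ℝ}

theorem maxSlope_nonneg (x z : Fin (n + 1) → ℝ) : 0 ≤ maxSlope x z :=
  Real.iSup_nonneg fun _ => abs_nonneg _

theorem abs_slope_le_maxSlope (x z : Fin (n + 1) → ℝ) (i : Fin n) :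
    |(z i.succ - z i.castSucc) / (x i.succ - x i.castSucc)| ≤ maxSlope x z :=
  le_ciSup (f := fun i : Fin n => |(z i.succ - z i.castSucc) / (x i.succ - x i.castSucc)|)
    (Set.finite_range _).bddAbove i

theorem maxSlope_le {z : Fin (n + 1) → ℝ} {K : ℝ} (hK : 0 ≤ K)
    (h : ∀ i : Fin n, |(z i.succ - z i.castSucc) / (x i.succ - x i.castSucc)| ≤ K) :
    maxSlope x z ≤ K :=
  Real.iSup_le h hK

/-- The consecutive bounds say that `z - L x` decreases and `z + L x` increases, with `L` the
largest slope; monotonicity carries them to all pairs. -/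
theorem abs_sub_le_maxSlope_mul (hx : StrictMono x) (z : Fin (n + 1) → ℝ) (i j : Fin (n + 1)) :
    |z i - z j| ≤ maxSlope x z * |x i - x j| := by
  have hs : ∀ i : Fin n, |z i.succ - z i.castSucc| ≤
      maxSlope x z * (x i.succ - x i.castSucc) := fun i => by
    have hpos : 0 < x i.succ - x i.castSucc := sub_pos.2 (hx Fin.castSucc_lt_succ)
    have := abs_slope_le_maxSlope x z i
    rwa [abs_div, abs_of_pos hpos, div_le_iff₀ hpos] at this
  have hanti : Antitone fun i => z i - maxSlope x z * x i :=
    Fin.antitone_iff_succ_le.2 fun i => by have := (abs_le.1 (hs i)).2; linarith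
  have hmono : Monotone fun i => z i + maxSlope x z * x i :=
    Fin.monotone_iff_le_succ.2 fun i => by have := (abs_le.1 (hs i)).1; linarith
  have key : ∀ i j, i ≤ j → |z i - z j| ≤ maxSlope x z * |x i - x j| := by
    intro i j hij
    have h1 := hanti hij
    have h2 := hmono hij
    simp only at h1 h2
    rw [abs_of_nonpos (sub_nonpos.2 (hx.monotone hij)), abs_le]
    constructor <;> linarith
  rcases le_total i j with h | h
  · exact key i j h
  · rw [abs_sub_comm, abs_sub_comm (x i)]
    exact key j i h

theorem maxSlope_le_of_interpolates (hx : StrictMono x) {z : Fin (n + 1) → ℝ} {f : ℝ → ℝ} {K : ℝ}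
    (hf : Interpolates x z f) (h : ∀ s t, |f s - f t| ≤ K * |s - t|) : maxSlope x z ≤ K := by
  refine maxSlope_le (nonneg_of_abs_sub_le h) fun i => ?_
  have hpos : 0 < |x i.succ - x i.castSucc| :=
    abs_pos.2 (sub_pos.2 (hx Fin.castSucc_lt_succ)).ne'
  rw [abs_div, div_le_iff₀ hpos, ← hf, ← hf]
  exact h _ _

theorem maxSlope_le_lipConst (hx : StrictMono x) {z : Fin (n + 1) → ℝ} {f : ℝ → ℝ}
    (hfL : f ∈ LipR) (hf : Interpolates x z f) : maxSlope x z ≤ lipConst f :=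
  maxSlope_le_of_interpolates hx hf (abs_sub_le_lipConst_mul hfL)

/-- The index `none` carries the extra point `p`, which may lie above a data abscissa. -/
theorem exists_interpolates_through (hx : StrictMono x) (z : Fin (n + 1) → ℝ) (p : ℝ × ℝ)
    (hp : ∀ m, |p.2 - z m| ≤ maxSlope x z * |p.1 - x m|) :
    ∃ f : ℝ → ℝ, (∀ s t, |f s - f t| ≤ maxSlope x z * |s - t|) ∧ Interpolates x z f ∧
      f p.1 = p.2 := by
  obtain ⟨f, hf, hfP⟩ := exists_lipschitz_through
    (fun o : Option (Fin (n + 1)) => o.elim p fun m => (x m, z m)) (maxSlope_nonneg x z) (by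
      rintro (_ | i) (_ | j)
      · simp
      · exact hp j
      · rw [abs_sub_comm, abs_sub_comm (Prod.fst _)]
        exact hp i
      · exact abs_sub_le_maxSlope_mul hx z i j)
  exact ⟨f, hf, fun m => hfP (some m), hfP none⟩

theorem exists_interpolates (hx : StrictMono x) (z : Fin (n + 1) → ℝ) :
    ∃ f : ℝ → ℝ, (∀ s t, |f s - f t| ≤ maxSlope x z * |s - t|) ∧ Interpolates x z f := by
  obtain ⟨f, h1, h2, -⟩ := exists_interpolates_through hx z (x 0, z 0) fun m =>
    abs_sub_le_maxSlope_mul hx z 0 m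
  exact ⟨f, h1, h2⟩

/-- Data chords bound the Lipschitz constant below by `maxSlope`, and Lipschitz extension attains
it. Optimality thus becomes a family of pointwise closed convex conditions. -/
theorem mem_lipInterpSolutions_iff (hx : StrictMono x) {z : Fin (n + 1) → ℝ} {f : LipR} :
    f ∈ lipInterpSolutions x z ↔ Interpolates x z f ∧
      ∀ s t, |(f : ℝ → ℝ) s - (f : ℝ → ℝ) t| ≤ maxSlope x z * |s - t| := by
  constructor
  · rintro ⟨h1, h2⟩
    refine ⟨h1, fun s t => (abs_sub_le_lipConst_mul f.2 s t).trans ?_⟩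
    obtain ⟨g, hg, hgi⟩ := exists_interpolates hx z
    exact mul_le_mul_of_nonneg_right
      ((h2 ⟨g, mem_LipR_of_abs_sub_le hg⟩ hgi).trans (lipConst_le hg)) (abs_nonneg _)
  · rintro ⟨h1, h2⟩
    exact ⟨h1, fun g hg => (lipConst_le h2).trans (maxSlope_le_lipConst hx g.2 hg)⟩

theorem nonempty_lipInterpSolutions (hx : StrictMono x) (z : Fin (n + 1) → ℝ) :
    (lipInterpSolutions x z).Nonempty := by
  obtain ⟨g, hg, hgi⟩ := exists_interpolates hx z
  exact ⟨⟨g, mem_LipR_of_abs_sub_le hg⟩, (mem_lipInterpSolutions_iff hx).2 ⟨hgi, hg⟩⟩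

theorem lipConst_eq_of_mem_lipInterpSolutions (hx : StrictMono x) {z : Fin (n + 1) → ℝ}
    {f : LipR} (hf : f ∈ lipInterpSolutions x z) : lipConst f = maxSlope x z := by
  have h := (mem_lipInterpSolutions_iff hx).1 hf
  exact le_antisymm (lipConst_le h.2) (maxSlope_le_lipConst hx f.2 h.1)

theorem convex_lipInterpSolutions (hx : StrictMono x) (z : Fin (n + 1) → ℝ) :
    Convex ℝ (lipInterpSolutions x z) := by
  intro f hf g hg a b ha hb hab
  rw [mem_lipInterpSolutions_iff hx] at hf hg ⊢
  refine ⟨fun m => ?_, fun s t => ?_⟩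
  · simp only [Submodule.coe_add, Submodule.coe_smul, Pi.add_apply, Pi.smul_apply, smul_eq_mul,
      hf.1 m, hg.1 m]
    rw [← add_mul, hab, one_mul]
  · simp only [Submodule.coe_add, Submodule.coe_smul, Pi.add_apply, Pi.smul_apply, smul_eq_mul]
    have h1 := mul_le_mul_of_nonneg_left (hf.2 s t) ha
    have h2 := mul_le_mul_of_nonneg_left (hg.2 s t) hb
    calc |a * (f : ℝ → ℝ) s + b * (g : ℝ → ℝ) s - (a * (f : ℝ → ℝ) t + b * (g : ℝ → ℝ) t)|
        = |a * ((f : ℝ → ℝ) s - (f : ℝ → ℝ) t) + b * ((g : ℝ → ℝ) s - (g : ℝ → ℝ) t)| := by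
          congr 1; ring
      _ ≤ a * |(f : ℝ → ℝ) s - (f : ℝ → ℝ) t| + b * |(g : ℝ → ℝ) s - (g : ℝ → ℝ) t| := by
          refine (abs_add_le _ _).trans_eq ?_
          rw [abs_mul, abs_mul, abs_of_nonneg ha, abs_of_nonneg hb]
      _ ≤ (a + b) * (maxSlope x z * |s - t|) := by linarith
      _ = maxSlope x z * |s - t| := by rw [hab, one_mul]

theorem continuous_maxSlope (x : Fin (n + 1) → ℝ) : Continuous (maxSlope x) := by
  -- With a single point the supremum is over an empty family, whose default real value is 0.
  rcases isEmpty_or_nonempty (Fin n) with h | h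
  · have : maxSlope x = fun _ => 0 := by
      funext z
      exact Real.iSup_of_isEmpty _
    rw [this]
    exact continuous_const
  · have : maxSlope x = fun z => Finset.univ.sup' Finset.univ_nonempty
        fun i : Fin n => |(z i.succ - z i.castSucc) / (x i.succ - x i.castSucc)| := by
      funext z
      rw [Finset.sup'_univ_eq_ciSup]
      rfl
    rw [this]
    exact Continuous.finset_sup'_apply _ fun i _ => by fun_prop

theorem maxSlope_midpoint_le (x z z' : Fin (n + 1) → ℝ) :
    maxSlope x (fun m => 2⁻¹ * z m + 2⁻¹ * z' m) ≤ 2⁻¹ * maxSlope x z + 2⁻¹ * maxSlope x z' := by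
  refine maxSlope_le (add_nonneg (mul_nonneg (by norm_num) (maxSlope_nonneg x z))
    (mul_nonneg (by norm_num) (maxSlope_nonneg x z'))) fun i => ?_
  have h1 := abs_slope_le_maxSlope x z i
  have h2 := abs_slope_le_maxSlope x z' i
  rw [abs_le] at h1 h2 ⊢
  have e : (2⁻¹ * z i.succ + 2⁻¹ * z' i.succ - (2⁻¹ * z i.castSucc + 2⁻¹ * z' i.castSucc)) /
      (x i.succ - x i.castSucc) = 2⁻¹ * ((z i.succ - z i.castSucc) / (x i.succ - x i.castSucc)) +
        2⁻¹ * ((z' i.succ - z' i.castSucc) / (x i.succ - x i.castSucc)) := by ring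
  rw [e]
  constructor <;> linarith [h1.1, h1.2, h2.1, h2.2]

/-! ### The optimal values at the data points -/

/-- The smallest cost of a Lipschitz function with given values at the data points. -/
noncomputable def valueCost (E : ℝ → ℝ → ℝ) (lam : ℝ) (x y z : Fin (n + 1) → ℝ) : ℝ :=
  ∑ m, E (z m) (y m) + lam * maxSlope x z

theorem exists_valueCost_min (E : ℝ → ℝ → ℝ)
    (hE_convex : ∀ v, StrictConvexOn ℝ univ (fun u => E u v))
    (hE_coercive : ∀ v, Tendsto (fun u => E u v) (cocompact ℝ) atTop)
    {lam : ℝ} (hlam : 0 < lam) (x y : Fin (n + 1) → ℝ) :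
    ∃ z, ∀ z', valueCost E lam x y z ≤ valueCost E lam x y z' := by
  have hcont : ∀ v, Continuous fun u => E u v := fun v =>
    continuousOn_univ.1 ((hE_convex v).convexOn.continuousOn isOpen_univ)
  have hbdd : ∀ v, ∃ B, ∀ u, B ≤ E u v := fun v => by
    obtain ⟨u, hu⟩ := (hcont v).exists_forall_le (hE_coercive v)
    exact ⟨_, hu⟩
  choose B hB using hbdd
  have hP : Continuous (valueCost E lam x y) := by
    refine Continuous.add (continuous_finsetSum _ fun m _ => ?_)
      (continuous_const.mul (continuous_maxSlope x))
    exact (hcont (y m)).comp (continuous_apply m)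
  -- If one data term exceeds `C + B (y m)`, the lower bounds `B` on the others already push the
  -- cost above its value at 0.
  set C := valueCost E lam x y 0 - ∑ m, B (y m) with hC
  have hK : ∀ m, ∃ K : Set ℝ, IsCompact K ∧ ∀ u ∉ K, C + B (y m) < E u (y m) := fun m => by
    have := (hE_coercive (y m)).eventually_gt_atTop (C + B (y m))
    obtain ⟨K, hK, hKs⟩ := mem_cocompact.1 this
    exact ⟨K, hK, fun u hu => hKs hu⟩
  choose K hKc hKs using hK
  refine hP.exists_forall_le' 0 ?_
  refine mem_cocompact.2 ⟨Set.pi univ K, isCompact_univ_pi hKc, fun z hz => ?_⟩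
  have hz' : ∃ m, z m ∉ K m := by simpa [Set.mem_pi] using hz
  obtain ⟨m, hm⟩ := hz'
  have h1 := hKs m _ hm
  have h2 : ∑ k, (E (z k) (y k) - B (y k)) ≥ E (z m) (y m) - B (y m) :=
    Finset.single_le_sum (f := fun k => E (z k) (y k) - B (y k))
      (fun k _ => sub_nonneg.2 (hB _ _)) (Finset.mem_univ m)
  rw [Finset.sum_sub_distrib] at h2
  have h3 := mul_nonneg hlam.le (maxSlope_nonneg x z)
  show valueCost E lam x y 0 ≤ valueCost E lam x y z
  have h4 : valueCost E lam x y z = ∑ m, E (z m) (y m) + lam * maxSlope x z := rfl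
  linarith

/-- At the midpoint, strictness comes from a coordinate where the two vectors differ; `maxSlope`
only needs to be convex. -/
theorem valueCost_min_unique {E : ℝ → ℝ → ℝ}
    (hE_convex : ∀ v, StrictConvexOn ℝ univ (fun u => E u v))
    {lam : ℝ} (hlam : 0 < lam) {x y z z' : Fin (n + 1) → ℝ}
    (hz : ∀ w, valueCost E lam x y z ≤ valueCost E lam x y w)
    (hz' : valueCost E lam x y z' ≤ valueCost E lam x y z) : z' = z := by
  by_contra hne
  obtain ⟨k, hk⟩ := Function.ne_iff.1 hne
  have h1 : ∀ m, E (2⁻¹ * z m + 2⁻¹ * z' m) (y m) ≤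
      2⁻¹ * E (z m) (y m) + 2⁻¹ * E (z' m) (y m) := fun m =>
    (hE_convex (y m)).convexOn.2 (mem_univ (z m)) (mem_univ (z' m)) (by norm_num : (0 : ℝ) ≤ 2⁻¹)
      (by norm_num : (0 : ℝ) ≤ 2⁻¹) (by norm_num)
  have h2 : E (2⁻¹ * z k + 2⁻¹ * z' k) (y k) < 2⁻¹ * E (z k) (y k) + 2⁻¹ * E (z' k) (y k) :=
    (hE_convex (y k)).2 (mem_univ (z k)) (mem_univ (z' k)) (Ne.symm hk)
      (by norm_num : (0 : ℝ) < 2⁻¹) (by norm_num : (0 : ℝ) < 2⁻¹) (by norm_num)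
  have h3 := Finset.sum_lt_sum (fun m _ => h1 m) ⟨k, Finset.mem_univ k, h2⟩
  rw [Finset.sum_add_distrib, ← Finset.mul_sum, ← Finset.mul_sum] at h3
  have h4 := mul_le_mul_of_nonneg_left (maxSlope_midpoint_le x z z') hlam.le
  have h5 := hz fun m => 2⁻¹ * z m + 2⁻¹ * z' m
  simp only [valueCost] at h5 hz'
  linarith

theorem lipSolutions_eq_of_valueCost_min {E : ℝ → ℝ → ℝ}
    (hE_convex : ∀ v, StrictConvexOn ℝ univ (fun u => E u v))
    {lam : ℝ} (hlam : 0 < lam) {x y z : Fin (n + 1) → ℝ} (hx : StrictMono x)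
    (hz : ∀ w, valueCost E lam x y z ≤ valueCost E lam x y w) :
    lipSolutions E lam x y = lipInterpSolutions x z := by
  have hlow : ∀ g : LipR, valueCost E lam x y (fun m => (g : ℝ → ℝ) (x m)) ≤
      lipCost E lam x y g := fun g =>
    add_le_add le_rfl (mul_le_mul_of_nonneg_left
      (maxSlope_le_lipConst hx g.2 fun _ => rfl) hlam.le)
  have hval : ∀ g ∈ lipInterpSolutions x z, lipCost E lam x y g = valueCost E lam x y z :=
    fun g hg => by
      rw [lipCost, valueCost, lipConst_eq_of_mem_lipInterpSolutions hx hg]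
      simp only [hg.1 _]
  ext f
  constructor
  · intro hf
    obtain ⟨g, hg⟩ := nonempty_lipInterpSolutions hx z
    have h1 := (hf g).trans_eq (hval g hg)
    have hfz : (fun m => (f : ℝ → ℝ) (x m)) = z :=
      valueCost_min_unique hE_convex hlam hz ((hlow f).trans h1)
    have hfi : Interpolates x z f := fun m => congrFun hfz m
    rw [lipCost, valueCost] at h1
    simp only [hfi _] at h1
    -- The sampled values agree, so the data terms cancel and `lam > 0` can be divided out.
    have h2 : lipConst f ≤ maxSlope x z :=
      le_of_mul_le_mul_left (by linarith) hlam
    exact (mem_lipInterpSolutions_iff hx).2 ⟨hfi, fun s t =>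
      (abs_sub_le_lipConst_mul f.2 s t).trans (mul_le_mul_of_nonneg_right h2 (abs_nonneg _))⟩
  · intro hf g
    rw [hval f hf]
    exact (hz _).trans (hlow g)

end MaxSlope

/-! ### Cones -/

theorem mem_vadd_rightCone_iff {L : ℝ} (hL : 0 ≤ L) (q p : ℝ × ℝ) :
    p ∈ q +ᵥ rightCone L ↔ q.1 ≤ p.1 ∧ |p.2 - q.2| ≤ L * (p.1 - q.1) := by
  rw [Set.mem_vadd_set_iff_neg_vadd_mem]
  constructor
  · rintro ⟨a, b, ha, hb, h⟩
    have h1 := congrArg Prod.fst h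
    have h2 := congrArg Prod.snd h
    simp at h1 h2
    have e1 : p.1 - q.1 = a + b := by linarith
    have e2 : p.2 - q.2 = L * (a - b) := by linarith
    refine ⟨by linarith, ?_⟩
    rw [e1, e2, abs_mul, abs_of_nonneg hL]
    exact mul_le_mul_of_nonneg_left (abs_le.2 ⟨by linarith, by linarith⟩) hL
  · rintro ⟨h1, h2⟩
    -- For zero slope the cone is a horizontal ray and its weights are not unique. Otherwise they
    -- solve `a + b = p.1 - q.1` and `a - b = (p.2 - q.2) / L`.
    rcases hL.eq_or_lt with rfl | hL
    · rw [zero_mul, abs_nonpos_iff] at h2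
      refine ⟨p.1 - q.1, 0, by linarith, le_rfl, Prod.ext ?_ ?_⟩
      · simp; ring
      · simp; linarith
    · have h3 : |(p.2 - q.2) / L| ≤ p.1 - q.1 := by
        rw [abs_div, abs_of_pos hL, div_le_iff₀ hL]
        linarith
      rw [abs_le] at h3
      refine ⟨(p.1 - q.1 + (p.2 - q.2) / L) / 2, (p.1 - q.1 - (p.2 - q.2) / L) / 2,
        by linarith, by linarith, Prod.ext ?_ ?_⟩
      · simp; ring
      · simp; field_simp; ring

theorem mem_vadd_leftCone_iff {L : ℝ} (hL : 0 ≤ L) (q p : ℝ × ℝ) :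
    p ∈ q +ᵥ leftCone L ↔ p.1 ≤ q.1 ∧ |p.2 - q.2| ≤ L * (q.1 - p.1) := by
  have h : p ∈ q +ᵥ leftCone L ↔ q ∈ p +ᵥ rightCone L := by
    rw [Set.mem_vadd_set_iff_neg_vadd_mem, Set.mem_vadd_set_iff_neg_vadd_mem, leftCone,
      Set.mem_neg]
    simp [add_comm]
  rw [h, mem_vadd_rightCone_iff hL, abs_sub_comm]

/-! ### The union of the graphs -/

/-- The condition is vacuous when `m` matches no data point, which absorbs the default value `univ`;
`k` is the zero-based index. -/
theorem mem_rightConeAt_iff {M : ℕ} (x z : Fin M → ℝ) {L : ℝ} (hL : 0 ≤ L) (m : ℕ) (p : ℝ × ℝ) :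
    p ∈ rightConeAt x z L m ↔ ∀ k (hk : k < M), m = k + 1 →
      x ⟨k, hk⟩ ≤ p.1 ∧ |p.2 - z ⟨k, hk⟩| ≤ L * (p.1 - x ⟨k, hk⟩) := by
  rw [rightConeAt]
  split_ifs with h
  · rw [mem_vadd_rightCone_iff hL]
    constructor
    · rintro h' k hk rfl
      exact h'
    · exact fun h' => h' (m - 1) (by omega) (by omega)
  · refine iff_of_true (mem_univ _) fun k hk hmk => absurd ⟨?_, ?_⟩ h <;> omega

theorem mem_leftConeAt_iff {M : ℕ} (x z : Fin M → ℝ) {L : ℝ} (hL : 0 ≤ L) (m : ℕ) (p : ℝ × ℝ) :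
    p ∈ leftConeAt x z L m ↔ ∀ k (hk : k < M), m = k + 1 →
      p.1 ≤ x ⟨k, hk⟩ ∧ |p.2 - z ⟨k, hk⟩| ≤ L * (x ⟨k, hk⟩ - p.1) := by
  rw [leftConeAt]
  split_ifs with h
  · rw [mem_vadd_leftCone_iff hL]
    constructor
    · rintro h' k hk rfl
      exact h'
    · exact fun h' => h' (m - 1) (by omega) (by omega)
  · refine iff_of_true (mem_univ _) fun k hk hmk => absurd ⟨?_, ?_⟩ h <;> omega

theorem unionGraph_lipInterpSolutions {n : ℕ} {x : Fin (n + 1) → ℝ} (hx : StrictMono x)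
    (z : Fin (n + 1) → ℝ) :
    unionGraph (lipInterpSolutions x z) =
      ⋃ m ∈ Finset.Icc 1 (n + 1 + 1),
        rightConeAt x z (maxSlope x z) (m - 1) ∩ leftConeAt x z (maxSlope x z) m := by
  have hL := maxSlope_nonneg x z
  ext p
  simp only [mem_iUnion, mem_inter_iff, mem_rightConeAt_iff x z hL, mem_leftConeAt_iff x z hL,
    Finset.mem_Icc, exists_prop]
  constructor
  · rintro ⟨f, hf, hp⟩
    obtain ⟨hfi, hfL⟩ := (mem_lipInterpSolutions_iff hx).1 hf
    have hr : ∀ k, x k ≤ p.1 → x k ≤ p.1 ∧ |p.2 - z k| ≤ maxSlope x z * (p.1 - x k) := by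
      intro k hk
      have := hfL p.1 (x k)
      rw [hfi k, ← hp, abs_of_nonneg (sub_nonneg.2 hk)] at this
      exact ⟨hk, this⟩
    have hl : ∀ k, p.1 ≤ x k → p.1 ≤ x k ∧ |p.2 - z k| ≤ maxSlope x z * (x k - p.1) := by
      intro k hk
      have := hfL p.1 (x k)
      rw [hfi k, ← hp, abs_sub_comm p.1, abs_of_nonneg (sub_nonneg.2 hk)] at this
      exact ⟨hk, this⟩
    -- The strip containing `p` ends at the first data point not to its left, or is the last,
    -- unbounded one.
    by_cases h : ∃ k, ∃ hk : k < n + 1, p.1 ≤ x ⟨k, hk⟩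
    · classical
      obtain ⟨hlt, hle⟩ := Nat.find_spec h
      refine ⟨Nat.find h + 1, ⟨by omega, by omega⟩, ?_, ?_⟩
      · intro k hk hkm
        refine hr _ (le_of_lt (not_le.1 fun h' => Nat.find_min h (m := k) (by omega) ⟨hk, h'⟩))
      · intro k hk hkm
        obtain rfl : k = Nat.find h := by omega
        exact hl _ hle
    · push Not at h
      refine ⟨n + 1 + 1, ⟨by omega, le_rfl⟩, fun k hk _ => hr _ (h k hk).le, ?_⟩
      intro k hk hkm
      omega
  · rintro ⟨m, ⟨hm1, hm2⟩, hR, hLft⟩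
    obtain ⟨f, hf, hfi, hfp⟩ := exists_interpolates_through hx z p (by
      rintro ⟨j, hj⟩
      -- The neighbours of `p` have zero-based indices `m - 2` and `m - 1`. Their cone bounds reach
      -- every farther point `j` on the same side by the triangle inequality.
      rcases le_or_gt (j + 2) m with hjm | hjm
      · have hk : m - 2 < n + 1 := by omega
        obtain ⟨h1, h2⟩ := hR (m - 2) hk (by omega)
        have h3 := abs_sub_le_maxSlope_mul hx z ⟨m - 2, hk⟩ ⟨j, hj⟩
        have h4 : x ⟨j, hj⟩ ≤ x ⟨m - 2, hk⟩ := hx.monotone (Fin.mk_le_mk.2 (by omega))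
        rw [abs_of_nonneg (sub_nonneg.2 h4)] at h3
        rw [abs_of_nonneg (by linarith : 0 ≤ p.1 - x ⟨j, hj⟩)]
        have := abs_sub_le p.2 (z ⟨m - 2, hk⟩) (z ⟨j, hj⟩)
        linarith
      · have hk : m - 1 < n + 1 := by omega
        obtain ⟨h1, h2⟩ := hLft (m - 1) hk (by omega)
        have h3 := abs_sub_le_maxSlope_mul hx z ⟨m - 1, hk⟩ ⟨j, hj⟩
        have h4 : x ⟨m - 1, hk⟩ ≤ x ⟨j, hj⟩ := hx.monotone (Fin.mk_le_mk.2 (by omega))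
        rw [abs_of_nonpos (sub_nonpos.2 h4)] at h3
        rw [abs_of_nonpos (by linarith : p.1 - x ⟨j, hj⟩ ≤ 0)]
        have := abs_sub_le p.2 (z ⟨m - 1, hk⟩) (z ⟨j, hj⟩)
        linarith)
    exact ⟨⟨f, mem_LipR_of_abs_sub_le hf⟩, (mem_lipInterpSolutions_iff hx).2 ⟨hfi, hf⟩, hfp.symm⟩

/-! ### Weak* compactness -/

theorem integral_deriv_mul_eq_neg {f h : ℝ → ℝ} {K : ℝ≥0} (hf : LipschitzWith K f)
    (hh : ContDiff ℝ ∞ h) (hc : HasCompactSupport h) :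
    ∫ t, deriv f t * h t = -∫ t, f t * deriv h t := by
  obtain ⟨C, hC⟩ := hh.lipschitzWith_of_hasCompactSupport hc (by simp)
  have h1 : ∀ g : ℝ → ℝ, ∀ t, lineDeriv ℝ g t 1 = deriv g t := fun g t => by
    simp [lineDeriv, deriv_comp_const_add]
  have := hf.integral_lineDeriv_mul_eq (μ := volume) hC hc (1 : ℝ)
  simp only [lineDeriv_neg, h1] at this
  rw [this, ← integral_neg]
  congr 1
  funext t
  ring

theorem tendsto_integral_mul_of_lipschitz {F : ℕ → ℝ → ℝ} {f : ℝ → ℝ} {K A : ℝ}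
    (hF : ∀ n s t, |F n s - F n t| ≤ K * |s - t|) (hA : ∀ n, |F n 0| ≤ A)
    (hlim : ∀ t, Tendsto (fun n => F n t) atTop (𝓝 (f t))) {g : ℝ → ℝ}
    (hg : Integrable g) (hg1 : Integrable fun t => |t| * g t) :
    Tendsto (fun n => ∫ t, F n t * g t) atTop (𝓝 (∫ t, f t * g t)) := by
  refine tendsto_integral_of_dominated_convergence
    (fun t => A * |g t| + K * |(|t| * g t)|) ?_ ?_ ?_ ?_
  · exact fun n => ((lipschitzWith_of_abs_sub_le (hF n)).continuous.aestronglyMeasurable).mul hg.1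
  · exact (hg.abs.const_mul A).add (hg1.abs.const_mul K)
  · refine fun n => Eventually.of_forall fun t => ?_
    have h1 := hF n t 0
    have h2 := abs_sub_abs_le_abs_sub (F n t) (F n 0)
    rw [sub_zero] at h1
    rw [Real.norm_eq_abs, abs_mul, abs_mul, abs_abs, ← mul_assoc, ← add_mul]
    exact mul_le_mul_of_nonneg_right (by linarith [hA n]) (abs_nonneg _)
  · exact Eventually.of_forall fun t => (hlim t).mul_const _

theorem abs_integral_deriv_mul_le {f g : ℝ → ℝ} {K : ℝ}
    (hf : ∀ s t, |f s - f t| ≤ K * |s - t|) (hg : Integrable g) :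
    |∫ t, deriv f t * g t| ≤ K * ∫ t, |g t| := by
  rw [← integral_const_mul, ← Real.norm_eq_abs]
  refine norm_integral_le_of_norm_le (hg.abs.const_mul K) (Eventually.of_forall fun t => ?_)
  rw [norm_mul, Real.norm_eq_abs (g t)]
  refine mul_le_mul_of_nonneg_right ?_ (abs_nonneg _)
  simpa [Real.coe_toNNReal _ (nonneg_of_abs_sub_le hf)] using
    norm_deriv_le_of_lipschitz (x₀ := t) (lipschitzWith_of_abs_sub_le hf)

/-- The derivatives need not converge pointwise. For a smooth compactly supported `g`, integration
by parts moves the derivative onto `g`; density in `L¹` and the uniform bound `K` on derivatives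
give the general case. -/
theorem tendsto_integral_deriv_mul_of_lipschitz {F : ℕ → ℝ → ℝ} {f : ℝ → ℝ} {K A : ℝ}
    (hF : ∀ n s t, |F n s - F n t| ≤ K * |s - t|) (hf : ∀ s t, |f s - f t| ≤ K * |s - t|)
    (hA : ∀ n, |F n 0| ≤ A) (hlim : ∀ t, Tendsto (fun n => F n t) atTop (𝓝 (f t)))
    {g : ℝ → ℝ} (hg : Integrable g) :
    Tendsto (fun n => ∫ t, deriv (F n) t * g t) atTop (𝓝 (∫ t, deriv f t * g t)) := by
  have hK := nonneg_of_abs_sub_le hf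
  rw [Metric.tendsto_atTop]
  intro ε hε
  -- Using `K + 1` avoids a zero denominator while keeping `K * η ≤ ε / 4`.
  set η : ℝ := ε / (4 * (K + 1)) with hη
  have hη0 : 0 < η := by positivity
  have hKη : K * η ≤ ε / 4 := by
    have : (K + 1) * η = ε / 4 := by rw [hη]; field_simp
    nlinarith
  obtain ⟨h, hc, hh, hgh⟩ := MemLp.exist_eLpNorm_sub_le (μ := volume) ENNReal.one_ne_top le_rfl
    (memLp_one_iff_integrable.2 hg) hη0
  have hhi : Integrable h := hh.continuous.integrable_of_hasCompactSupport hc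
  have hsub : Integrable (g - h) := hg.sub hhi
  have hnorm : ∫ t, |(g - h) t| ≤ η := by
    rw [eLpNorm_one_eq_lintegral_enorm, ← ofReal_integral_norm_eq_lintegral_enorm hsub,
      ENNReal.ofReal_le_ofReal_iff hη0.le] at hgh
    exact hgh
  have hsplit : ∀ u : ℝ → ℝ, (∀ s t, |u s - u t| ≤ K * |s - t|) →
      |(∫ t, deriv u t * g t) - ∫ t, deriv u t * h t| ≤ ε / 4 := by
    intro u hu
    have h_integral : ∀ k : ℝ → ℝ, Integrable k → Integrable fun t => deriv u t * k t := fun k hk =>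
      hk.bdd_mul (measurable_deriv _).aestronglyMeasurable (Eventually.of_forall fun t =>
        norm_deriv_le_of_lipschitz (lipschitzWith_of_abs_sub_le hu))
    rw [← integral_sub (h_integral g hg) (h_integral h hhi)]
    simp only [← mul_sub]
    exact (abs_integral_deriv_mul_le hu hsub).trans
      ((mul_le_mul_of_nonneg_left hnorm hK).trans hKη)
  have hsm : Tendsto (fun n => ∫ t, deriv (F n) t * h t) atTop (𝓝 (∫ t, deriv f t * h t)) := by
    have hh' : Continuous (deriv h) := (contDiff_infty_iff_deriv.1 hh).2.continuous
    simp only [integral_deriv_mul_eq_neg (lipschitzWith_of_abs_sub_le (hF _)) hh hc,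
      integral_deriv_mul_eq_neg (lipschitzWith_of_abs_sub_le hf) hh hc]
    refine (tendsto_integral_mul_of_lipschitz hF hA hlim ?_ ?_).neg
    · exact hh'.integrable_of_hasCompactSupport hc.deriv
    · exact (continuous_abs.mul hh').integrable_of_hasCompactSupport hc.deriv.mul_left
  obtain ⟨N, hN⟩ := Metric.tendsto_atTop.1 hsm (ε / 4) (by positivity)
  refine ⟨N, fun n hn => ?_⟩
  have h1 := hN n hn
  have h2 := hsplit _ (hF n)
  have h3 := hsplit _ hf
  rw [Real.dist_eq] at h1 ⊢
  rw [abs_le] at h2 h3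
  rw [abs_lt] at h1 ⊢
  constructor <;> linarith [h1.1, h1.2, h2.1, h2.2, h3.1, h3.2]

/-- The set is compact in `C(ℝ, ℝ)` by Arzelà–Ascoli, because the value at `x 0` is fixed and the
Lipschitz bound is uniform; the inclusion into the weak* topology is continuous on it. -/
theorem isWeakStarCompact_lipInterpSolutions {n : ℕ} {x : Fin (n + 1) → ℝ} (hx : StrictMono x)
    (z : Fin (n + 1) → ℝ) : IsWeakStarCompact (lipInterpSolutions x z) := by
  set L := maxSlope x z with hLdef
  let S : Set C(ℝ, ℝ) := {F | Interpolates x z F ∧ ∀ s t, |F s - F t| ≤ L * |s - t|}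
  have hbound : ∀ f : ℝ → ℝ, Interpolates x z f → (∀ s t, |f s - f t| ≤ L * |s - t|) → ∀ t,
      |f t - z 0| ≤ L * |t - x 0| := fun f hi hf t => by
    rw [← hi 0]
    exact hf t (x 0)
  have hS : IsCompact S := by
    refine ArzelaAscoli.isCompact_of_equicontinuous S ?_ ?_
    · have himg : ContinuousMap.toFun '' S =
          {f : ℝ → ℝ | Interpolates x z f ∧ ∀ s t, |f s - f t| ≤ L * |s - t|} := by
        ext f
        constructor
        · rintro ⟨F, hF, rfl⟩
          exact hF
        · exact fun hf => ⟨⟨f, (lipschitzWith_of_abs_sub_le hf.2).continuous⟩, hf, rfl⟩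
      rw [himg]
      have hpi : IsCompact (Set.pi univ fun t : ℝ => Metric.closedBall (z 0) (L * |t - x 0|)) :=
        isCompact_univ_pi fun t => isCompact_closedBall _ _
      refine hpi.of_isClosed_subset ?_ ?_
      · simp only [Interpolates, ofPred_and, ofPred_forall]
        refine IsClosed.inter (isClosed_iInter fun m => ?_)
          (isClosed_iInter fun s => isClosed_iInter fun t => ?_)
        · exact isClosed_eq (continuous_apply _) continuous_const
        · exact isClosed_le ((continuous_apply s).sub (continuous_apply t)).abs continuous_const
      · rintro f ⟨hi, hf⟩ t -
        rw [Metric.mem_closedBall, Real.dist_eq]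
        exact hbound f hi hf t
    · refine LipschitzWith.uniformEquicontinuous _ L.toNNReal (fun F => ?_) |>.equicontinuous
      exact lipschitzWith_of_abs_sub_le F.2.2
  let Φ : S → LipR := fun F => ⟨F.1, mem_LipR_of_abs_sub_le F.2.2⟩
  have hΦ : @Continuous S LipR _ lipWeakStar Φ := by
    refine continuous_induced_rng.2 (continuous_pi fun w => ?_)
    -- Sequences suffice in the compact-open topology on `C(ℝ, ℝ)`, which makes dominated
    -- convergence available.
    refine continuous_iff_seqContinuous.2 fun F G hFG => ?_
    have hlim : ∀ t, Tendsto (fun n => (F n).1 t) atTop (𝓝 (G.1 t)) := fun t =>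
      (((ContinuousEvalConst.continuous_eval_const t).comp continuous_subtype_val).tendsto G).comp hFG
    have hA : ∀ n, |(F n).1 0| ≤ L * |0 - x 0| + |z 0| := fun n => by
      have h1 := hbound _ (F n).2.1 (F n).2.2 0
      have h2 := abs_sub_abs_le_abs_sub ((F n).1 0) (z 0)
      linarith
    have h0 : Integrable (fun t : ℝ => Real.exp (-t ^ 2)) := by
      simpa using integrable_exp_neg_mul_sq (b := 1) one_pos
    have h1 : Integrable (fun t : ℝ => |t| * Real.exp (-t ^ 2)) := by
      have h : Integrable (fun t : ℝ => t * Real.exp (-t ^ 2)) := by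
        simpa using integrable_mul_exp_neg_mul_sq (b := 1) one_pos
      simpa [abs_mul, abs_of_pos (Real.exp_pos _)] using h.abs
    exact (tendsto_integral_deriv_mul_of_lipschitz (fun n => (F n).2.2) G.2.2 hA hlim
      (L1.integrable_coeFn w.1)).neg.add
      ((tendsto_integral_mul_of_lipschitz (fun n => (F n).2.2) hA hlim h0 h1).const_mul w.2)
  have hrange : lipInterpSolutions x z = Φ '' univ := by
    ext f
    rw [mem_lipInterpSolutions_iff hx]
    constructor
    · exact fun hf => ⟨⟨⟨f, (lipschitzWith_of_abs_sub_le hf.2).continuous⟩, hf⟩, mem_univ _, rfl⟩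
    · rintro ⟨F, -, rfl⟩
      exact F.2
  rw [hrange]
  have : CompactSpace S := isCompact_iff_compactSpace.1 hS
  exact @IsCompact.image _ _ _ lipWeakStar _ _ isCompact_univ hΦ

/-! ### Minimizers of the second-order total variation -/

section SplineInterpolation

variable {N : ℕ} {x z : Fin (N + 1 + 1) → ℝ}

/-- Extension of a finite sequence by zero. -/
def extendZero {M : ℕ} (x : Fin M → ℝ) (k : ℕ) : ℝ := if h : k < M then x ⟨k, h⟩ else 0

theorem extendZero_of_lt {M : ℕ} (x : Fin M → ℝ) {k : ℕ} (h : k < M) :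
    extendZero x k = x ⟨k, h⟩ := dif_pos h

theorem extendZero_lt_succ {n : ℕ} {x : Fin (n + 1) → ℝ} (hx : StrictMono x) (k : ℕ)
    (hk : k < n) : extendZero x k < extendZero x (k + 1) := by
  rw [extendZero_of_lt x (by omega : k < n + 1), extendZero_of_lt x (by omega : k + 1 < n + 1)]
  exact hx (Fin.mk_lt_mk.2 (Nat.lt_succ_self k))

theorem Interpolates.apply_extendZero {n : ℕ} {x z : Fin (n + 1) → ℝ} {f : ℝ → ℝ}
    (hf : Interpolates x z f) (k : ℕ) (hk : k ≤ n) :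
    f (extendZero x k) = extendZero z k := by
  rw [extendZero_of_lt x (Nat.lt_succ_of_le hk), extendZero_of_lt z (Nat.lt_succ_of_le hk)]
  exact hf _

theorem interpolates_linearSpline (hx : StrictMono x) :
    Interpolates x z (linearSpline (extendZero x) (extendZero z) N) := by
  intro m
  have := linearSpline_apply (extendZero z) (extendZero_lt_succ hx)
    (Nat.le_of_lt_succ m.2)
  rwa [extendZero_of_lt x m.2, extendZero_of_lt z m.2] at this

/-- All interpolants share the same chord slopes over the data intervals, so the lower bound for any
of them matches the upper bound for the spline. -/
theorem linearSpline_mem_tv2InterpSolutions (hx : StrictMono x) :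
    linearSpline (extendZero x) (extendZero z) N ∈ tv2InterpSolutions x z := by
  have hTV := TV2_linearSpline_le (extendZero x) (extendZero z) N
  refine ⟨⟨(isCPWL_linearSpline _ _ _).1, hTV.trans_lt ENNReal.ofReal_lt_top⟩,
    interpolates_linearSpline hx, fun g hg hgi => hTV.trans ?_⟩
  rw [← map_chordSlope_successiveIntervals hgi.apply_extendZero]
  refine ofReal_listVariation_chordSlope_le_TV2 hg.1 _ (fun J hJ => ?_)
    (pairwise_successiveIntervals (extendZero_lt_succ hx)).isChain
  obtain ⟨k, hk, rfl⟩ := mem_successiveIntervals.1 hJ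
  exact extendZero_lt_succ hx k hk

theorem abs_sub_le_of_mem_tv2InterpSolutions (hx : StrictMono x) {f : ℝ → ℝ}
    (hf : f ∈ tv2InterpSolutions x z) (s t : ℝ) : |f s - f t| ≤ maxSlope x z * |s - t| := by
  obtain ⟨hfB, hfi, hmin⟩ := hf
  have hspline := linearSpline_mem_tv2InterpSolutions (z := z) hx
  refine abs_sub_le_mul_of_TV2_le hfB.1 (extendZero_lt_succ hx) (Nat.le_add_left 1 N)
    (fun k hk => ?_) ?_ s t
  · have h1 := hfi.apply_extendZero k hk.le
    have h2 := hfi.apply_extendZero (k + 1) hk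
    simp only [chordSlope, h1, h2]
    rw [extendZero_of_lt x (by omega : k < N + 1 + 1), extendZero_of_lt z (by omega),
      extendZero_of_lt x (by omega : k + 1 < N + 1 + 1), extendZero_of_lt z (by omega)]
    exact abs_slope_le_maxSlope x z ⟨k, hk⟩
  · rw [map_chordSlope_successiveIntervals hfi.apply_extendZero]
    exact (hmin _ hspline.1 hspline.2.1).trans (TV2_linearSpline_le _ _ _)

end SplineInterpolation

/-! ### Assembly of the main theorem -/

theorem TV2_const (c : ℝ) : TV2 (fun _ => c) = 0 := by
  have := TV2_affine_add_sum_hinge_le (∅ : Finset ℕ) c 0 0 0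
  simpa using this

theorem theorem2 {n : ℕ} (E : ℝ → ℝ → ℝ)
    (hE_convex : ∀ v, StrictConvexOn ℝ univ (fun u => E u v))
    (hE_coercive : ∀ v, Tendsto (fun u => E u v) (cocompact ℝ) atTop)
    (lam : ℝ) (hlam : 0 < lam)
    (x y : Fin (n + 1) → ℝ) (hx : StrictMono x) :
    -- the solution set is nonempty, convex and weak*-compact
    ((lipSolutions E lam x y).Nonempty ∧ Convex ℝ (lipSolutions E lam x y) ∧
      IsWeakStarCompact (lipSolutions E lam x y)) ∧
    -- reduction to an interpolation problem, with a unique vector of values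
    (∃! z : Fin (n + 1) → ℝ, lipSolutions E lam x y = lipInterpSolutions x z) ∧
    ∀ z : Fin (n + 1) → ℝ, lipSolutions E lam x y = lipInterpSolutions x z →
      -- the optimal Lipschitz constant
      ((∀ f ∈ lipSolutions E lam x y, lipConst f = maxSlope x z) ∧
        ∀ f : ℝ → ℝ, (∀ s t, |f s - f t| ≤ maxSlope x z * |s - t|) → Interpolates x z f →
          ∃ hf : f ∈ LipR, (⟨f, hf⟩ : LipR) ∈ lipSolutions E lam x y) ∧
      -- the union of the graphs of the solutions
      unionGraph (lipSolutions E lam x y) =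
        (⋃ m ∈ Finset.Icc 1 (n + 1 + 1),
          rightConeAt x z (maxSlope x z) (m - 1) ∩ leftConeAt x z (maxSlope x z) m) ∧
      -- minimal second-order total-variation interpolants (of at least two points) are solutions
      (1 ≤ n → ∀ f ∈ tv2InterpSolutions x z,
        ∃ hf : f ∈ LipR, (⟨f, hf⟩ : LipR) ∈ lipSolutions E lam x y) ∧
      -- there is a continuous and piecewise-linear solution, which is such an interpolant
      ∃ f ∈ lipSolutions E lam x y, IsCPWL f ∧ (f : ℝ → ℝ) ∈ tv2InterpSolutions x z := by
  obtain ⟨z₀, hz₀⟩ := exists_valueCost_min E hE_convex hE_coercive hlam x y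
  have heq := lipSolutions_eq_of_valueCost_min hE_convex hlam hx hz₀
  refine ⟨?_, ⟨z₀, heq, fun z hz => ?_⟩, fun z hz => ?_⟩
  · rw [heq]
    exact ⟨nonempty_lipInterpSolutions hx z₀, convex_lipInterpSolutions hx z₀,
      isWeakStarCompact_lipInterpSolutions hx z₀⟩
  -- Any admissible `z` must be the vector of values of a solution, and a solution exists.
  · obtain ⟨f, hf⟩ := nonempty_lipInterpSolutions hx z₀
    have hf' : f ∈ lipInterpSolutions x z := by rwa [← hz, heq]
    funext m
    rw [← hf.1 m, ← hf'.1 m]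
  · rw [hz]
    have hmem : ∀ f : ℝ → ℝ, (∀ s t, |f s - f t| ≤ maxSlope x z * |s - t|) →
        Interpolates x z f → ∃ hf : f ∈ LipR, (⟨f, hf⟩ : LipR) ∈ lipInterpSolutions x z :=
      fun f hf hfi => ⟨mem_LipR_of_abs_sub_le hf, (mem_lipInterpSolutions_iff hx).2 ⟨hfi, hf⟩⟩
    refine ⟨⟨fun f hf => lipConst_eq_of_mem_lipInterpSolutions hx hf, hmem⟩,
      unionGraph_lipInterpSolutions hx z, fun hn f hf => ?_, ?_⟩
    · obtain ⟨N, rfl⟩ := Nat.exists_eq_add_of_le' hn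
      exact hmem f (abs_sub_le_of_mem_tv2InterpSolutions hx hf) hf.2.1
    -- The spline needs two points; for a single one the constant function has zero `TV2`.
    · cases n with
      | zero =>
        obtain ⟨hf, hsol⟩ := hmem (fun _ => z 0)
          (fun s t => by simpa using mul_nonneg (maxSlope_nonneg x z) (abs_nonneg (s - t)))
          (fun m => congrArg z (Fin.ext (by omega)))
        refine ⟨_, hsol, by simpa using isCPWL_affine (z 0) 0, ?_⟩
        refine ⟨⟨continuous_const, ?_⟩, hsol.1, fun g _ _ => ?_⟩
        · rw [TV2_const]
          exact ENNReal.zero_lt_top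
        · rw [TV2_const]
          exact zero_le
      | succ N =>
        have hs := linearSpline_mem_tv2InterpSolutions (z := z) hx
        obtain ⟨hf, hsol⟩ := hmem _ (abs_sub_le_of_mem_tv2InterpSolutions hx hs) hs.2.1
        exact ⟨_, hsol, isCPWL_linearSpline _ _ _, hs⟩
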